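/- A cluster graph is a disjoint union of complete graphs. A cluster deletion set of a finite simple graph $G$ is a set $X\subseteq V(G)$ such that $G-X$ is a cluster graph, and the distance of $G$ to cluster graphs is the minimum size of a cluster deletion set. In 2-Load Coloring the input is a finite simple graph $G$ with two integers $k_1,k_2$, and the question is whether there is a coloring $f:V(G)\to\{r,b\}$ such that at least $k_1$ edges have both end vertices colored $r$ and at least $k_2$ edges have both end vertices colored $b$. Running times are numbers of steps of a uniform-cost random access machine with addition and subtraction, and graphs are given by their adjacency matrices. Theorem. (a) 2-Load Coloring is fixed-parameter tractable parameterized by the distance to cluster graphs: it can be decided in time $f(d)\cdot N^{O(1)}$, where $N$ is the input size, $d$ is the distance of $G$ to cluster graphs and $f$ is a computable function. No deletion set is given. (b) There is an algorithm that, given an instance $(G,k_1,k_2)$ with $n$ vertices and $m$ edges together with a cluster deletion set $X$ of $G$ of size $k$, always halts with the correct answer, and does so in time $O(2^k n^3 m^2)$ whenever $m\ge 1$, where the implied constant is absolute. -/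

import Mathlib

namespace LoadColoring

/-! ### Graphs and 2-colorings -/

/-- The two colors. -/
inductive Color where
  | red
  | blue

/-- The number of edges of `G` both of whose end vertices have color `c` under `f`. -/
noncomputable def monoEdges {V : Type} (G : SimpleGraph V) (f : V → Color) (c : Color) : ℕ :=
  {e ∈ G.edgeSet | ∀ v ∈ e, f v = c}.ncard

/-- `(G, k₁, k₂)` is a yes-instance of 2-Load Coloring: some 2-coloring has at least `k₁` red
edges and at least `k₂` blue edges. -/
def HasLoadColoring {V : Type} (G : SimpleGraph V) (k₁ k₂ : ℤ) : Prop :=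
  ∃ f : V → Color, k₁ ≤ (monoEdges G f Color.red : ℤ) ∧ k₂ ≤ (monoEdges G f Color.blue : ℤ)

/-- A cluster graph is a disjoint union of complete graphs: the vertex set is partitioned (into
the classes of an equivalence relation) so that two distinct vertices are adjacent if and only
if they lie in the same part. -/
def IsCluster {V : Type} (G : SimpleGraph V) : Prop :=
  ∃ r : Setoid V, ∀ u v : V, G.Adj u v ↔ u ≠ v ∧ r u v

/-- `X` is a cluster deletion set of `G`: the graph `G - X` is a cluster graph. -/
def IsClusterDeletionSet {V : Type} (G : SimpleGraph V) (X : Finset V) : Prop :=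
  IsCluster (G.induce {v | v ∉ X})

/-- The distance to cluster graphs: the least size of a cluster deletion set. (The infimum is
over a nonempty set when `V` is finite.) -/
noncomputable def clusterDistance {V : Type} (G : SimpleGraph V) : ℕ :=
  sInf {d | ∃ X : Finset V, IsClusterDeletionSet G X ∧ X.card = d}

/-! ### Random access machines

A uniform-cost random access machine over the integers, with addition and subtraction as the
only arithmetic operations. A program is a finite term, so it names only finitely many registers
and finitely many memory arrays. -/

/-- A memory state: the registers, and the arrays (array number, then address). -/
structure State where
  reg : ℕ → ℤ
  mem : ℕ → ℤ → ℤ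

/-- Elementary instructions. Register numbers and array numbers are fixed in the program; the
addresses used by `load` and `store` are the contents of a register. -/
inductive Instr where
  /-- `reg d := z` -/
  | const (d : ℕ) (z : ℤ)
  /-- `reg d := reg a + reg b` -/
  | add (d a b : ℕ)
  /-- `reg d := reg a - reg b` -/
  | sub (d a b : ℕ)
  /-- `reg d := mem i (reg a)` -/
  | load (d i a : ℕ)
  /-- `mem i (reg a) := reg b` -/
  | store (i a b : ℕ)

/-- The effect of an elementary instruction. -/
def Instr.apply : Instr → State → State
  | .const d z, s => { s with reg := Function.update s.reg d z }
  | .add d a b, s => { s with reg := Function.update s.reg d (s.reg a + s.reg b) }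
  | .sub d a b, s => { s with reg := Function.update s.reg d (s.reg a - s.reg b) }
  | .load d i a, s => { s with reg := Function.update s.reg d (s.mem i (s.reg a)) }
  | .store i a b, s =>
      { s with mem := Function.update s.mem i
                  (Function.update (s.mem i) (s.reg a) (s.reg b)) }

/-- Programs. -/
inductive Prog where
  | skip
  | instr (i : Instr)
  | seq (p q : Prog)
  /-- if `reg a < reg b` then `p` else `q` -/
  | ifLt (a b : ℕ) (p q : Prog)
  /-- while `reg a < reg b` do `p` -/
  | whileLt (a b : ℕ) (p : Prog)

/-- `Exec p s t s'`: started in the state `s`, the program `p` halts in the state `s'` after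
exactly `t` steps. Every executed instruction and every evaluated test is one step. -/
inductive Exec : Prog → State → ℕ → State → Prop where
  | skip (s : State) : Exec .skip s 1 s
  | instr (i : Instr) (s : State) : Exec (.instr i) s 1 (i.apply s)
  | seq {p q : Prog} {s s' s'' : State} {t t' : ℕ} :
      Exec p s t s' → Exec q s' t' s'' → Exec (.seq p q) s (t + t') s''
  | ifTrue {a b : ℕ} {p q : Prog} {s s' : State} {t : ℕ} :
      s.reg a < s.reg b → Exec p s t s' → Exec (.ifLt a b p q) s (t + 1) s'
  | ifFalse {a b : ℕ} {p q : Prog} {s s' : State} {t : ℕ} :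
      ¬ s.reg a < s.reg b → Exec q s t s' → Exec (.ifLt a b p q) s (t + 1) s'
  | whileFalse {a b : ℕ} {p : Prog} {s : State} :
      ¬ s.reg a < s.reg b → Exec (.whileLt a b p) s 1 s
  | whileTrue {a b : ℕ} {p : Prog} {s s' s'' : State} {t t' : ℕ} :
      s.reg a < s.reg b → Exec p s t s' → Exec (.whileLt a b p) s' t' s'' →
        Exec (.whileLt a b p) s (t + t' + 1) s''

/-- Execution is deterministic. -/
theorem Exec.deterministic {p : Prog} {s s₁ s₂ : State} {t₁ t₂ : ℕ}
    (h₁ : Exec p s t₁ s₁) (h₂ : Exec p s t₂ s₂) : t₁ = t₂ ∧ s₁ = s₂ := by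
  induction h₁ generalizing t₂ s₂ with
  | skip s => cases h₂; exact ⟨rfl, rfl⟩
  | instr i s => cases h₂; exact ⟨rfl, rfl⟩
  | seq _ _ ih ih' =>
    cases h₂ with
    | seq h h' =>
      obtain ⟨rfl, rfl⟩ := ih h
      obtain ⟨rfl, rfl⟩ := ih' h'
      exact ⟨rfl, rfl⟩
  | ifTrue hlt _ ih =>
    cases h₂ with
    | ifTrue _ h => obtain ⟨rfl, rfl⟩ := ih h; exact ⟨rfl, rfl⟩
    | ifFalse hn _ => exact absurd hlt hn
  | ifFalse hn _ ih =>
    cases h₂ with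
    | ifTrue hlt _ => exact absurd hlt hn
    | ifFalse _ h => obtain ⟨rfl, rfl⟩ := ih h; exact ⟨rfl, rfl⟩
  | whileFalse hn =>
    cases h₂ with
    | whileFalse _ => exact ⟨rfl, rfl⟩
    | whileTrue hlt _ _ => exact absurd hlt hn
  | whileTrue hlt _ _ ih ih' =>
    cases h₂ with
    | whileFalse hn => exact absurd hlt hn
    | whileTrue _ h h' =>
      obtain ⟨rfl, rfl⟩ := ih h
      obtain ⟨rfl, rfl⟩ := ih' h'
      exact ⟨rfl, rfl⟩

open Classical in
/-- Started in `s`, the program `p` halts after exactly `t` steps and leaves in register `0` the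
answer (`1` for yes, `0` for no) to the question whether `Q` holds. -/
def Answers (p : Prog) (s : State) (Q : Prop) (t : ℕ) : Prop :=
  ∃ s' : State, Exec p s t s' ∧ s'.reg 0 = if Q then 1 else 0

/-! ### Problem instances and their encoding -/

/-- An instance of 2-Load Coloring; the vertices are numbered `0, …, n - 1`. -/
structure Instance where
  n : ℕ
  graph : SimpleGraph (Fin n)
  k₁ : ℤ
  k₂ : ℤ

/-- The yes-instances of 2-Load Coloring. -/
def Instance.IsYes (I : Instance) : Prop := HasLoadColoring I.graph I.k₁ I.k₂

/-- The number of edges. -/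
noncomputable def Instance.m (I : Instance) : ℕ := I.graph.edgeSet.ncard

/-- The number of words in the encoding of the instance: the adjacency matrix, `n`, `k₁`, `k₂`. -/
def Instance.size (I : Instance) : ℕ := I.n * I.n + 3

open Classical in
/-- The initial state that encodes an instance together with a vertex set `X`: the registers
`0, 1, 2` hold `n, k₁, k₂`, array `0` holds the adjacency matrix row by row, array `1` holds the
characteristic vector of `X`, and everything else is zero. -/
noncomputable def Instance.encodeWith (I : Instance) (X : Finset (Fin I.n)) : State where
  reg r := if r = 0 then (I.n : ℤ) else if r = 1 then I.k₁ else if r = 2 then I.k₂ else 0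
  mem i x :=
    if i = 0 ∧ ∃ u v : Fin I.n, x = ((u : ℕ) : ℤ) * I.n + ((v : ℕ) : ℤ) ∧ I.graph.Adj u v then 1
    else if i = 1 ∧ ∃ v : Fin I.n, x = ((v : ℕ) : ℤ) ∧ v ∈ X then 1
    else 0

/-- The encoding of an instance alone (no vertex set is given). -/
noncomputable def Instance.encode (I : Instance) : State := I.encodeWith ∅

/-- A decision problem with instances `ι`, encoded by `encode` with input size `size`, is
fixed-parameter tractable with respect to the parameter `κ`: one program decides it in at most
`f (κ x) * (size x) ^ c` steps, for some computable `f` and some constant `c`. -/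
def FixedParameterTractable {ι : Type} (encode : ι → State) (size : ι → ℕ) (Yes : ι → Prop)
    (κ : ι → ℕ) : Prop :=
  ∃ (p : Prog) (f : ℕ → ℕ) (c : ℕ), Computable f ∧
    ∀ x : ι, ∃ t : ℕ, Answers p (encode x) (Yes x) t ∧ t ≤ f (κ x) * size x ^ c

end LoadColoring

namespace LoadColoring

/-! ### Programs built from counted loops -/

/-! Fix a set X whose removal leaves a disjoint union of cliques, and a coloring of X. A vertex u
outside X has a(u) red and b(u) blue neighbors in X. Edges are counted as ordered pairs, hence
twice. Then the red count of any extension is a constant for X, plus 2a(u) for every red u outside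
X, plus the ordered pairs of distinct red vertices in a common clique; blue is symmetric
(`pairs_eq`). So within a clique only the number of red vertices matters.

This gives a dynamic program over the cliques. For the vertices seen so far, the table stores, for
each number i of red vertices in the current clique and each red value p, the greatest blue value. A
new vertex in a clique with c earlier vertices either turns blue and gains 2(b + c - i), or turns
red and gains 2(a + i - 1), where i already includes it (`reach_insert`, `isTable_newEntry`). When a
clique is complete, i is forgotten by a maximum over the rows (`isTable_merge`). Since p is at most
2m, the table has (n + 1)(2m + 1) entries. Trying all colorings of X, numbered in binary, decides
the instance (`extends_iff`, `search_spec`).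

The cliques are recognized by labels: outside X every vertex receives the greatest vertex of its
clique. This needs only that no induced path on three vertices avoids X (`label_spec`). The same
property serves when no set is given: greedily collected disjoint induced paths on three vertices
form such a set, and every deletion set meets each of these paths, so the set has at most 3d
elements (`Packed`, `greedy_spec`) and at most 8^d colorings.

On the machine side, all programs are built from counted loops whose bounds sit in registers that
the program never writes. A running time bound can then be read off the syntax (`exec_compile`), and
correctness is proved separately for the function `run` by loop invariants (`loop_induction`). The
result is O(2^k n^3 m) steps when m is positive, which is within the claimed bound. -/

/-- Set a register. -/
def State.set (s : State) (r : ℕ) (z : ℤ) : State :=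
  { s with reg := Function.update s.reg r z }

/-- Set a memory cell. -/
def State.put (s : State) (i : ℕ) (x z : ℤ) : State :=
  { s with mem := Function.update s.mem i (Function.update (s.mem i) x z) }

@[simp] theorem State.reg_set (s : State) (r r' : ℕ) (z : ℤ) :
    (s.set r z).reg r' = if r' = r then z else s.reg r' := by
  simp [State.set, Function.update_apply]

@[simp] theorem State.mem_set (s : State) (r : ℕ) (z : ℤ) : (s.set r z).mem = s.mem := rfl

@[simp] theorem State.reg_put (s : State) (i : ℕ) (x z : ℤ) : (s.put i x z).reg = s.reg := rfl

@[simp] theorem State.mem_put (s : State) (i j : ℕ) (x y z : ℤ) :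
    (s.put i x z).mem j y = if j = i then (if y = x then z else s.mem i y) else s.mem j y := by
  by_cases h : j = i
  · subst h; simp [State.put, Function.update_apply]
  · simp [State.put, h]

/-- Programs whose only loops are counted loops. -/
inductive LoopProg where
  | skip
  | instr (i : Instr)
  | seq (p q : LoopProg)
  | ifLt (a b : ℕ) (p q : LoopProg)
  /-- for `reg r = 0, …, reg b - 1` do `p` -/
  | loop (r b : ℕ) (p : LoopProg)

namespace LoopProg

infixr:60 " ;; " => LoopProg.seq

/-- `reg d := z` -/
abbrev const (d : ℕ) (z : ℤ) : LoopProg := instr (.const d z)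
/-- `reg d := reg a + reg b` -/
abbrev add (d a b : ℕ) : LoopProg := instr (.add d a b)
/-- `reg d := reg a - reg b` -/
abbrev sub (d a b : ℕ) : LoopProg := instr (.sub d a b)
/-- `reg d := mem i (reg a)` -/
abbrev load (d i a : ℕ) : LoopProg := instr (.load d i a)
/-- `mem i (reg a) := reg b` -/
abbrev store (i a b : ℕ) : LoopProg := instr (.store i a b)

/-- Compilation; register `3` is assumed to hold `1`. -/
def compile : LoopProg → Prog
  | skip => .skip
  | instr i => .instr i
  | seq p q => .seq p.compile q.compile
  | ifLt a b p q => .ifLt a b p.compile q.compile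
  | loop r b p =>
      .seq (.instr (.const r 0)) (.whileLt r b (.seq p.compile (.instr (.add r r 3))))

/-- The state after `k` rounds of a counted loop over register `r` with body `f`. -/
def iter (f : State → State) (r : ℕ) (s : State) : ℕ → State
  | 0 => s.set r 0
  | k + 1 => (f (iter f r s k)).set r (k + 1 : ℕ)

/-- The effect of a program. -/
def run : LoopProg → State → State
  | skip, s => s
  | instr i, s => i.apply s
  | seq p q, s => q.run (p.run s)
  | ifLt a b p q, s => if s.reg a < s.reg b then p.run s else q.run s
  | loop r b p, s => iter p.run r s (s.reg b).toNat

@[simp] theorem run_skip (s : State) : run skip s = s := rfl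
@[simp] theorem run_const (d : ℕ) (z : ℤ) (s : State) : run (const d z) s = s.set d z := rfl
@[simp] theorem run_add (d a b : ℕ) (s : State) :
    run (add d a b) s = s.set d (s.reg a + s.reg b) := rfl
@[simp] theorem run_sub (d a b : ℕ) (s : State) :
    run (sub d a b) s = s.set d (s.reg a - s.reg b) := rfl
@[simp] theorem run_load (d i a : ℕ) (s : State) :
    run (load d i a) s = s.set d (s.mem i (s.reg a)) := rfl
@[simp] theorem run_store (i a b : ℕ) (s : State) :
    run (store i a b) s = s.put i (s.reg a) (s.reg b) := rfl
@[simp] theorem run_seq (p q : LoopProg) (s : State) : run (p ;; q) s = q.run (p.run s) := rfl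
@[simp] theorem run_ifLt (a b : ℕ) (p q : LoopProg) (s : State) :
    run (ifLt a b p q) s = if s.reg a < s.reg b then p.run s else q.run s := rfl
theorem run_loop (r b : ℕ) (p : LoopProg) (s : State) :
    run (loop r b p) s = iter p.run r s (s.reg b).toNat := rfl

/-! ### Frame conditions: what a program leaves unchanged -/

/-- The program does not write register `r`. -/
def keeps (r : ℕ) : LoopProg → Bool
  | skip => true
  | instr (.const d _) => d != r
  | instr (.add d _ _) => d != r
  | instr (.sub d _ _) => d != r
  | instr (.load d _ _) => d != r
  | instr (.store _ _ _) => true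
  | seq p q => p.keeps r && q.keeps r
  | ifLt _ _ p q => p.keeps r && q.keeps r
  | loop d _ p => d != r && p.keeps r

/-- The program does not write array `i`. -/
def keepsArr (i : ℕ) : LoopProg → Bool
  | instr (.store j _ _) => j != i
  | seq p q => p.keepsArr i && q.keepsArr i
  | ifLt _ _ p q => p.keepsArr i && q.keepsArr i
  | loop _ _ p => p.keepsArr i
  | _ => true

theorem iter_reg_of_ne {f : State → State} {r r' : ℕ} (h : r' ≠ r)
    (hf : ∀ s, (f s).reg r' = s.reg r') (s : State) (k : ℕ) :
    (iter f r s k).reg r' = s.reg r' := by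
  induction k with
  | zero => simp [iter, h]
  | succ k ih => simp [iter, h, hf, ih]

theorem iter_mem {f : State → State} {r i : ℕ}
    (hf : ∀ s, (f s).mem i = s.mem i) (s : State) (k : ℕ) :
    (iter f r s k).mem i = s.mem i := by
  induction k with
  | zero => simp [iter]
  | succ k ih => simp [iter, hf, ih]

theorem reg_iter (f : State → State) (r : ℕ) (s : State) (k : ℕ) :
    (iter f r s k).reg r = k := by
  cases k <;> simp [iter]

theorem reg_run (p : LoopProg) {r : ℕ} (h : p.keeps r = true) (s : State) :
    (p.run s).reg r = s.reg r := by
  induction p generalizing s with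
  | skip => rfl
  | instr i =>
    cases i <;> simp [run, Instr.apply, Function.update_apply] <;>
      (intro h'; simp [keeps, h'] at h)
  | seq p q ihp ihq =>
    simp only [keeps, Bool.and_eq_true] at h
    simp [ihp h.1, ihq h.2]
  | ifLt a b p q ihp ihq =>
    simp only [keeps, Bool.and_eq_true] at h
    simp only [run_ifLt]
    split_ifs <;> simp [ihp h.1, ihq h.2]
  | loop d b p ih =>
    simp only [keeps, Bool.and_eq_true, bne_iff_ne] at h
    exact iter_reg_of_ne h.1.symm (ih h.2) _ _

theorem mem_run (p : LoopProg) {i : ℕ} (h : p.keepsArr i = true) (s : State) :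
    (p.run s).mem i = s.mem i := by
  induction p generalizing s with
  | skip => rfl
  | instr j =>
    cases j with
    | store j a b =>
      have h' : i ≠ j := by rintro rfl; simp [keepsArr] at h
      simp [run, Instr.apply, h']
    | _ => rfl
  | seq p q ihp ihq =>
    simp only [keepsArr, Bool.and_eq_true] at h
    simp [ihp h.1, ihq h.2]
  | ifLt a b p q ihp ihq =>
    simp only [keepsArr, Bool.and_eq_true] at h
    simp only [run_ifLt]
    split_ifs <;> simp [ihp h.1, ihq h.2]
  | loop d b p ih => exact iter_mem (ih h) _ _

/-- `s'` agrees with `s` on all registers and arrays that `p` does not write. -/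
structure Frame (p : LoopProg) (s s' : State) : Prop where
  reg : ∀ r, p.keeps r = true → s'.reg r = s.reg r
  mem : ∀ i, p.keepsArr i = true → s'.mem i = s.mem i

/-- Noninterference is a syntactic check that evaluates to `true` on a concrete program, so later
uses need only `rfl` as proof. -/
theorem frame_run (p : LoopProg) (s : State) : p.Frame s (p.run s) :=
  ⟨fun _ h => reg_run p h s, fun _ h => mem_run p h s⟩

/-- Induction along a counted loop. -/
theorem loop_induction {r b : ℕ} {p : LoopProg} {s : State} {N : ℕ} (hN : s.reg b = N)
    (Inv : ℕ → State → Prop) (h0 : Inv 0 (s.set r 0))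
    (hstep : ∀ k < N, ∀ s' : State, (loop r b p).Frame s s' → s'.reg r = k → Inv k s' →
      Inv (k + 1) ((p.run s').set r (k + 1 : ℕ))) :
    Inv N ((loop r b p).run s) := by
  have key : ∀ k ≤ N, Inv k (iter p.run r s k) := by
    intro k
    induction k with
    | zero => exact fun _ => h0
    | succ k ih =>
      intro hk
      refine hstep k hk _ ⟨fun r' h => ?_, fun i h => iter_mem (mem_run p h) _ _⟩
        (reg_iter _ _ _ _) (ih (by lia))
      simp only [keeps, Bool.and_eq_true, bne_iff_ne] at h
      exact iter_reg_of_ne h.1.symm (reg_run p h.2) _ _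
  rw [run_loop, hN, Int.toNat_natCast]
  exact key N le_rfl

/-- The program writes none of the registers `rs` and none of the arrays `is`. -/
def keepsAll (rs is : List ℕ) (p : LoopProg) : Bool := rs.all p.keeps && is.all p.keepsArr

theorem Frame.of_keepsAll {p : LoopProg} {s s' : State} (h : p.Frame s s') {rs is : List ℕ}
    (hp : keepsAll rs is p = true) :
    (∀ r ∈ rs, s'.reg r = s.reg r) ∧ ∀ i ∈ is, s'.mem i = s.mem i := by
  simp only [keepsAll, Bool.and_eq_true, List.all_eq_true] at hp
  exact ⟨fun r hr => h.reg r (hp.1 r hr), fun i hi => h.mem i (hp.2 i hi)⟩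

/-! ### Running times read off the syntax -/

/-- The bounds of all loops lie in `B`, no register of `B` is written, and no loop variable is
written in the body of its loop. -/
def wf (B : List ℕ) : LoopProg → Bool
  | skip => true
  | instr i => B.all fun r => (instr i).keeps r
  | seq p q => p.wf B && q.wf B
  | ifLt _ _ p q => p.wf B && q.wf B
  | loop r b p => B.contains b && !B.contains r && p.keeps r && p.wf B

theorem wf.keeps {B : List ℕ} {p : LoopProg} (h : p.wf B = true) {r : ℕ} (hr : r ∈ B) :
    p.keeps r = true := by
  induction p with
  | skip => rfl
  | instr i => exact List.all_eq_true.1 h r hr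
  | seq p q ihp ihq =>
    simp only [wf, Bool.and_eq_true] at h
    simp [LoopProg.keeps, ihp h.1, ihq h.2]
  | ifLt a b p q ihp ihq =>
    simp only [wf, Bool.and_eq_true] at h
    simp [LoopProg.keeps, ihp h.1, ihq h.2]
  | loop d b p ih =>
    simp only [wf, Bool.and_eq_true, Bool.not_eq_true', List.contains_eq_mem,
      decide_eq_true_eq, decide_eq_false_iff_not] at h
    simp only [LoopProg.keeps, ih h.2, Bool.and_true, bne_iff_ne]
    rintro rfl
    exact h.1.1.2 hr

/-- An upper bound for the running time, in terms of the values of the loop bounds. -/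
def cost (β : ℕ → ℕ) : LoopProg → ℕ
  | skip => 1
  | instr _ => 1
  | seq p q => p.cost β + q.cost β
  | ifLt _ _ p q => p.cost β + q.cost β + 1
  | loop _ b p => β b * (p.cost β + 2) + 2

/-- Induction on the number `j` of remaining rounds. Each round pays for its body and one test; the
last `+ 1` is the failing test. -/
theorem exec_while {p : LoopProg} {r b : ℕ} {s : State} {c N : ℕ}
    (hN : s.reg b = N)
    (hp : ∀ k, ∃ t ≤ c, Exec (.seq p.compile (.instr (.add r r 3)))
      (iter p.run r s k) t (iter p.run r s (k + 1)))
    (hb : ∀ k, (iter p.run r s k).reg b = s.reg b) (j k : ℕ) (hjk : k + j = N) :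
    ∃ t ≤ j * (c + 1) + 1,
      Exec (.whileLt r b (.seq p.compile (.instr (.add r r 3))))
        (iter p.run r s k) t (iter p.run r s N) := by
  induction j generalizing k with
  | zero =>
    obtain rfl : k = N := by simpa using hjk
    exact ⟨1, by simp, .whileFalse (by simp [reg_iter, hb, hN])⟩
  | succ j ih =>
    obtain ⟨t, ht, h⟩ := hp k
    obtain ⟨t', ht', h'⟩ := ih (k + 1) (by lia)
    refine ⟨t + t' + 1, by nlinarith, .whileTrue ?_ h h'⟩
    rw [reg_iter, hb, hN]
    exact_mod_cast (by lia : k < N)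

/-- Registers in `B` are never written, so their initial values bound the rounds of every loop,
however deeply nested. Register `3` is among them because the compiled counters add it. -/
theorem exec_compile {B : List ℕ} {p : LoopProg} (h : p.wf B = true) (h3 : 3 ∈ B)
    {β : ℕ → ℕ} {s : State} (hs : s.reg 3 = 1) (hβ : ∀ b ∈ B, (s.reg b).toNat ≤ β b) :
    ∃ t ≤ p.cost β, Exec p.compile s t (p.run s) := by
  induction p generalizing s with
  | skip => exact ⟨1, le_rfl, .skip s⟩
  | instr i => exact ⟨1, le_rfl, .instr i s⟩
  | seq p q ihp ihq =>
    simp only [wf, Bool.and_eq_true] at h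
    obtain ⟨t, ht, e⟩ := ihp h.1 hs hβ
    obtain ⟨t', ht', e'⟩ := ihq (s := p.run s) h.2
      (by rw [reg_run p (wf.keeps h.1 h3), hs])
      (fun b hb => by rw [reg_run p (wf.keeps h.1 hb)]; exact hβ b hb)
    exact ⟨t + t', add_le_add ht ht', .seq e e'⟩
  | ifLt a b p q ihp ihq =>
    simp only [wf, Bool.and_eq_true] at h
    by_cases hab : s.reg a < s.reg b
    · obtain ⟨t, ht, e⟩ := ihp h.1 hs hβ
      refine ⟨t + 1, by simp only [cost]; lia, ?_⟩
      rw [run_ifLt, if_pos hab]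
      exact .ifTrue hab e
    · obtain ⟨t, ht, e⟩ := ihq h.2 hs hβ
      refine ⟨t + 1, by simp only [cost]; lia, ?_⟩
      rw [run_ifLt, if_neg hab]
      exact .ifFalse hab e
  | loop r b p ih =>
    have hw := h
    simp only [wf, Bool.and_eq_true, Bool.not_eq_true', List.contains_eq_mem,
      decide_eq_true_eq, decide_eq_false_iff_not] at h
    obtain ⟨⟨⟨hb, hr⟩, hrp⟩, hp⟩ := h
    have hkeep : ∀ b' ∈ B, ∀ k, (iter p.run r s k).reg b' = s.reg b' := fun b' hb' k =>
      iter_reg_of_ne (by rintro rfl; exact hr hb') (reg_run p (wf.keeps hp hb')) s k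
    have hbody : ∀ k, ∃ t ≤ p.cost β + 1, Exec (.seq p.compile (.instr (.add r r 3)))
        (iter p.run r s k) t (iter p.run r s (k + 1)) := by
      intro k
      obtain ⟨t, ht, e⟩ := ih (s := iter p.run r s k) hp (by rw [hkeep 3 h3, hs])
        (fun b' hb' => by rw [hkeep b' hb']; exact hβ b' hb')
      refine ⟨t + 1, by lia, .seq e ?_⟩
      have h1 : (p.run (iter p.run r s k)).reg r = k := by
        rw [reg_run p hrp, reg_iter]
      have h2 : (p.run (iter p.run r s k)).reg 3 = 1 := by
        rw [reg_run p (wf.keeps hp h3), hkeep 3 h3, hs]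
      -- `iter` sets the counter outright, the compiled loop increments it. They agree because the
      -- body keeps `r` and register `3` still holds `1`.
      have h4 : iter p.run r s (k + 1) =
          Instr.apply (.add r r 3) (p.run (iter p.run r s k)) := by
        simp only [iter, Instr.apply, State.set, h1, h2]
        push_cast
        rfl
      rw [h4]
      exact .instr _ _
    by_cases hpos : 0 ≤ s.reg b
    · obtain ⟨t, ht, e⟩ := exec_while (N := (s.reg b).toNat) (by simp [hpos]) hbody (hkeep b hb)
        (s.reg b).toNat 0 (by simp)
      refine ⟨1 + t, ?_, .seq (.instr _ _) e⟩
      have : (s.reg b).toNat * (p.cost β + 1 + 1) ≤ β b * (p.cost β + 2) :=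
        Nat.mul_le_mul_right _ (hβ b hb)
      simp only [cost]; lia
    -- A negative bound: `toNat` gives no rounds, and the first test of the compiled loop fails.
    · refine ⟨1 + 1, by simp only [cost]; lia, .seq (.instr (.const r 0) s) ?_⟩
      have hz : (s.reg b).toNat = 0 := by lia
      rw [run_loop, hz]
      refine .whileFalse ?_
      have := hkeep b hb 0
      have h0 := reg_iter p.run r s 0
      simp only [iter] at this h0
      have e : Instr.apply (.const r 0) s = s.set r 0 := rfl
      rw [e, this, h0]
      simp; lia

/-- `reg d := mem i (reg (mem 2 (reg a)) + reg b)`: read entry `(reg a, reg b)` of the matrix in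
array `i`, where array `2` holds the addresses at which the rows begin. -/
def entry (d a b : ℕ) : LoopProg := load d 2 a ;; add d d b ;; load d 0 d

end LoopProg

/-! ### Counting monochromatic edges along a cluster deletion set -/

open Finset

/-- The number of ordered pairs of adjacent vertices of `{0, …, n - 1}` that both satisfy `f`. -/
def pairs (n : ℕ) (adj : ℕ → ℕ → Bool) (f : ℕ → Bool) : ℕ :=
  ∑ u ∈ range n, ∑ w ∈ range n, if adj u w ∧ f u ∧ f w then 1 else 0

/-- The number of neighbors of `u` in the set `x` that satisfy `f`. -/
def nbrs (n : ℕ) (adj : ℕ → ℕ → Bool) (x f : ℕ → Bool) (u : ℕ) : ℕ :=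
  ∑ w ∈ range n, if adj u w ∧ x w ∧ f w then 1 else 0

/-- The number of ordered pairs of adjacent vertices of the set `x` that both satisfy `f`. -/
def base (n : ℕ) (adj : ℕ → ℕ → Bool) (x f : ℕ → Bool) : ℕ :=
  ∑ u ∈ range n, if x u ∧ f u then nbrs n adj x f u else 0

/-- The number of vertices in `D` with label `v` that satisfy `f`. -/
def cnt (L : ℕ → ℕ) (D : Finset ℕ) (v : ℕ) (f : ℕ → Bool) : ℕ :=
  ∑ w ∈ D, if L w = v ∧ f w then 1 else 0

/-- Twice the total weight of the vertices of `D` that satisfy `f`, plus the number of ordered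
pairs of distinct vertices of `D` that have the same label and satisfy `f`. -/
def value (a L : ℕ → ℕ) (D : Finset ℕ) (f : ℕ → Bool) : ℕ :=
  ∑ u ∈ D, if f u then 2 * a u + ∑ w ∈ D, (if w ≠ u ∧ L w = L u ∧ f w then 1 else 0) else 0

/-- Split the ordered pairs by which ends lie in `x`. Both ends inside give `base`; the two mixed
kinds are equinumerous by symmetry, whence the factor 2 on the weights in `value`; outside `x`,
adjacency means distinct vertices with the same label. -/
theorem pairs_eq {n : ℕ} {adj : ℕ → ℕ → Bool} {x : ℕ → Bool} {L : ℕ → ℕ}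
    (hsymm : ∀ u w, adj u w = adj w u)
    (hL : ∀ u < n, ∀ w < n, x u = false → x w = false → (adj u w = true ↔ w ≠ u ∧ L w = L u))
    (f : ℕ → Bool) :
    pairs n adj f = base n adj x f +
      value (nbrs n adj x f) L ({u ∈ range n | x u = false}) f := by
  have split : ∀ g : ℕ → ℕ, ∑ u ∈ range n, g u =
      (∑ u ∈ range n with x u = true, g u) + ∑ u ∈ range n with x u = false, g u := by
    intro g
    rw [← sum_filter_add_sum_filter_not (range n) (fun u => x u = true) g]
    simp
  have h1 : base n adj x f = ∑ u ∈ range n with x u = true, ∑ w ∈ range n with x w = true,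
      if adj u w ∧ f u ∧ f w then 1 else 0 := by
    rw [base, sum_filter]
    refine sum_congr rfl fun u _ => ?_
    rw [nbrs, sum_filter]
    by_cases hx : x u <;> by_cases hf : f u <;> simp [hx, hf, -sum_boole]
    refine sum_congr rfl fun w _ => ?_
    by_cases hx : x w <;> simp [hx]
  have h2 : ∑ u ∈ range n with x u = false, (if f u then nbrs n adj x f u else 0) =
      ∑ u ∈ range n with x u = false, ∑ w ∈ range n with x w = true,
      if adj u w ∧ f u ∧ f w then 1 else 0 := by
    refine sum_congr rfl fun u _ => ?_
    rw [nbrs, sum_filter]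
    by_cases hf : f u <;> simp [hf, -sum_boole]
    refine sum_congr rfl fun w _ => ?_
    by_cases hx : x w <;> simp [hx]
  have h3 : ∑ u ∈ range n with x u = true, ∑ w ∈ range n with x w = false,
      (if adj u w ∧ f u ∧ f w then 1 else 0) =
      ∑ u ∈ range n with x u = false, ∑ w ∈ range n with x w = true,
      if adj u w ∧ f u ∧ f w then 1 else 0 := by
    rw [sum_comm]
    refine sum_congr rfl fun u _ => sum_congr rfl fun w _ => ?_
    rw [hsymm w u]
    simp only [and_comm (a := f w = true)]
  have h4 : ∑ u ∈ range n with x u = false, ∑ w ∈ range n with x w = false,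
      (if adj u w ∧ f u ∧ f w then 1 else 0) =
      ∑ u ∈ range n with x u = false, if f u then
        ∑ w ∈ range n with x w = false, (if w ≠ u ∧ L w = L u ∧ f w then 1 else 0) else 0 := by
    refine sum_congr rfl fun u hu => ?_
    by_cases hf : f u <;> simp only [hf, Bool.false_eq_true, false_and, and_false, if_false,
      sum_const_zero, true_and, if_true]
    refine sum_congr rfl fun w hw => ?_
    simp only [mem_filter, mem_range] at hu hw
    simp only [hL u hu.1 w hw.1 hu.2 hw.2, and_assoc]
  have h5 : value (nbrs n adj x f) L ({u ∈ range n | x u = false}) f =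
      (∑ u ∈ range n with x u = false, (if f u then nbrs n adj x f u else 0)) +
      (∑ u ∈ range n with x u = false, (if f u then nbrs n adj x f u else 0)) +
      ∑ u ∈ range n with x u = false, if f u then
        ∑ w ∈ range n with x w = false, (if w ≠ u ∧ L w = L u ∧ f w then 1 else 0) else 0 := by
    rw [value, ← sum_add_distrib, ← sum_add_distrib]
    refine sum_congr rfl fun u _ => ?_
    split_ifs
    · ring
    · rfl
  have h6 : pairs n adj f = ∑ u ∈ range n,
      ((∑ w ∈ range n with x w = true, if adj u w ∧ f u ∧ f w then 1 else 0) +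
      ∑ w ∈ range n with x w = false, if adj u w ∧ f u ∧ f w then 1 else 0) := by
    rw [pairs]
    exact sum_congr rfl fun u _ => split _
  rw [h6, split, sum_add_distrib, sum_add_distrib, h5, h1, h2, h3, h4]
  ring

theorem cnt_insert {L : ℕ → ℕ} {D : Finset ℕ} {u : ℕ} (hu : u ∉ D) (v : ℕ) (f : ℕ → Bool) :
    cnt L (insert u D) v f = cnt L D v f + if L u = v ∧ f u then 1 else 0 := by
  rw [cnt, sum_insert hu, add_comm]; rfl

theorem cnt_add_cnt_not (L : ℕ → ℕ) (D : Finset ℕ) (v : ℕ) (f : ℕ → Bool) :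
    cnt L D v f + cnt L D v (fun w => !f w) = cnt L D v (fun _ => true) := by
  rw [cnt, cnt, cnt, ← sum_add_distrib]
  refine sum_congr rfl fun w _ => ?_
  by_cases h : L w = v <;> cases hf : f w <;> simp [h]

/-- Every earlier vertex `w` with the label of `u` that satisfies `f` yields two new ordered pairs:
`(u, w)` in the term of `u`, and `(w, u)` in the term of `w`. -/
theorem value_insert {a L : ℕ → ℕ} {D : Finset ℕ} {u : ℕ} (hu : u ∉ D) (f : ℕ → Bool) :
    value a L (insert u D) f =
      value a L D f + if f u then 2 * (a u + cnt L D (L u) f) else 0 := by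
  have h1 : ∀ w ∈ D, w ≠ u := fun w hw => by rintro rfl; exact hu hw
  rw [value, sum_insert hu]
  have h2 : ∀ w ∈ D, (if f w then 2 * a w + ∑ z ∈ insert u D,
        (if z ≠ w ∧ L z = L w ∧ f z then 1 else 0) else 0) =
      (if f w then 2 * a w + ∑ z ∈ D, (if z ≠ w ∧ L z = L w ∧ f z then 1 else 0) else 0) +
      (if f u then (if L w = L u ∧ f w then 1 else 0) else 0) := by
    intro w hw
    rw [sum_insert hu]
    have := (h1 w hw).symm
    by_cases hw' : f w <;> by_cases hu' : f u <;>
      simp [hw', hu', this, eq_comm (a := L u), -sum_boole]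
    ring
  rw [sum_congr rfl h2, sum_add_distrib, sum_insert hu]
  have h3 : ∑ w ∈ D, (if w ≠ u ∧ L w = L u ∧ f w then 1 else 0) = cnt L D (L u) f :=
    sum_congr rfl fun w hw => by simp [h1 w hw]
  have h4 : ∑ w ∈ D, (if f u then (if L w = L u ∧ f w then 1 else 0) else 0) =
      if f u then cnt L D (L u) f else 0 := by
    split_ifs
    · rfl
    · simp
  rw [h3, h4, value]
  by_cases hf : f u
  · simp only [hf, ne_eq, not_true_eq_false, false_and, if_false, if_true, zero_add]
    ring
  · simp only [hf, Bool.false_eq_true, if_false, zero_add, add_zero]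

theorem cnt_congr {L : ℕ → ℕ} {D : Finset ℕ} {v : ℕ} {f g : ℕ → Bool}
    (h : ∀ w ∈ D, f w = g w) : cnt L D v f = cnt L D v g :=
  sum_congr rfl fun w hw => by rw [h w hw]

theorem value_congr {a L : ℕ → ℕ} {D : Finset ℕ} {f g : ℕ → Bool}
    (h : ∀ w ∈ D, f w = g w) : value a L D f = value a L D g :=
  sum_congr rfl fun u hu => by
    rw [h u hu]
    congr 2
    exact sum_congr rfl fun w hw => by rw [h w hw]

/-! ### The dynamic programming table -/

/-- Some coloring of `D` colors exactly `i` vertices with label `v` red, and has red value `p` and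
blue value at least `q`. -/
def Reach (a b L : ℕ → ℕ) (D : Finset ℕ) (v i p : ℕ) (q : ℤ) : Prop :=
  ∃ f : ℕ → Bool, cnt L D v f = i ∧ value a L D f = p ∧ q ≤ value b L D (fun w => !f w)

/-- Blue values are natural numbers, so a negative demand is no weaker than the demand 0. Hence
tables need to be meaningful only for `q ≥ 0`. -/
theorem Reach.mono {a b L : ℕ → ℕ} {D : Finset ℕ} {v i p : ℕ} {q q' : ℤ}
    (h : Reach a b L D v i p q) (hq : q' ≤ max q 0) : Reach a b L D v i p q' := by
  obtain ⟨f, h1, h2, h3⟩ := h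
  refine ⟨f, h1, h2, ?_⟩
  lia

/-- Case distinction on the color of `u`. If blue, it pairs with the blue vertices of its group,
which are all but `i`; if red, with the other `i - 1` red ones. The guards in the second case keep
the natural subtractions exact. -/
theorem reach_insert {a b L : ℕ → ℕ} {D : Finset ℕ} {u v : ℕ} (hu : u ∉ D) (hv : L u = v)
    (i p : ℕ) (q : ℤ) :
    Reach a b L (insert u D) v i p q ↔
      Reach a b L D v i p (q - 2 * (b u + cnt L D v (fun _ => true) - i)) ∨
      0 < i ∧ 2 * (a u + (i - 1)) ≤ p ∧
        Reach a b L D v (i - 1) (p - 2 * (a u + (i - 1))) q := by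
  constructor
  · rintro ⟨f, h1, h2, h3⟩
    rw [cnt_insert hu] at h1
    rw [value_insert hu, hv] at h2 h3
    have h4 := cnt_add_cnt_not L D v f
    cases hf : f u
    · left
      simp only [hf, Bool.false_eq_true, and_false, if_false, add_zero, Bool.not_false,
        if_true] at h1 h2 h3
      exact ⟨f, h1, h2, by push_cast at h3; lia⟩
    · right
      simp only [hf, hv, and_self, if_true, Bool.not_true, Bool.false_eq_true, if_false,
        add_zero] at h1 h2 h3
      have : cnt L D v f = i - 1 := by lia
      rw [this] at h2
      exact ⟨by lia, by lia, f, this, by lia, h3⟩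
  -- A witness for `D` may be recolored at `u`, which lies outside `D`.
  · have upd : ∀ (f : ℕ → Bool) (c : Bool), ∀ w ∈ D, Function.update f u c w = f w :=
      fun f c w hw => Function.update_of_ne (by rintro rfl; exact hu hw) _ _
    have upd' : ∀ (f : ℕ → Bool) (c : Bool), ∀ w ∈ D, (!Function.update f u c w) = !f w :=
      fun f c w hw => by rw [upd f c w hw]
    rintro (⟨f, h1, h2, h3⟩ | ⟨hi, hp, f, h1, h2, h3⟩)
    · have h4 := cnt_add_cnt_not L D v f
      refine ⟨Function.update f u false, ?_, ?_, ?_⟩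
      · rw [cnt_insert hu, cnt_congr (upd f _)]; simp [h1]
      · rw [value_insert hu, value_congr (upd f _)]; simp [h2]
      · rw [value_insert hu, value_congr (upd' f _), hv, cnt_congr (upd' f _)]
        simp; lia
    · refine ⟨Function.update f u true, ?_, ?_, ?_⟩
      · rw [cnt_insert hu, cnt_congr (upd f _)]; simp [h1, hv]; lia
      · rw [value_insert hu, value_congr (upd f _), hv, cnt_congr (upd f _)]; simp [h1, h2]; lia
      · rw [value_insert hu, value_congr (upd' f _), hv, cnt_congr (upd' f _)]
        simpa using h3

/-- The table `T` with `N` entries and rows of length `S` records, for all `i` and `p`, the largest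
`q ≥ 0` that satisfies `A i p q`; a negative entry says that there is none. -/
def IsTable (S N : ℕ) (T : ℤ → ℤ) (A : ℕ → ℕ → ℤ → Prop) : Prop :=
  ∀ x : ℕ, x < N → ∀ q : ℤ, 0 ≤ q → (q ≤ T x ↔ A (x / S) (x % S) q)

/-- The new table entry at `x` when a blue vertex of weight `b` joins a group of `c` vertices. -/
def blueEntry (S : ℕ) (T : ℤ → ℤ) (b c : ℕ) (x : ℕ) : ℤ :=
  if T x < 0 then -1 else T x + 2 * (b + c - (x / S : ℕ))

/-- The new table entry at `x` when a vertex with weights `a` and `b` joins a group of `c`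
vertices. -/
def newEntry (S : ℕ) (T : ℤ → ℤ) (a b c : ℕ) (x : ℕ) : ℤ :=
  if 0 < x / S ∧ 2 * (a + (x / S - 1)) ≤ x % S then
    max (blueEntry S T b c x) (T ((x - S - 2 * (a + (x / S - 1)) : ℕ)))
  else blueEntry S T b c x

/-- This is `reach_insert` in terms of addresses: the disjunction becomes a maximum, and the red
alternative is looked up one row earlier. -/
theorem isTable_newEntry {a b L : ℕ → ℕ} {D : Finset ℕ} {u v S N : ℕ} {T T' : ℤ → ℤ}
    (hu : u ∉ D) (hv : L u = v) (hT : IsTable S N T (Reach a b L D v))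
    (hT' : ∀ x : ℕ, x < N →
      T' x = newEntry S T (a u) (b u) (cnt L D v (fun _ => true)) x) :
    IsTable S N T' (Reach a b L (insert u D) v) := by
  intro x hx q hq
  -- The demand that remains for `D` can be negative, where the table says nothing; `Reach.mono`
  -- moves it to 0.
  have hblue : q ≤ blueEntry S T (b u) (cnt L D v (fun _ => true)) x ↔ Reach a b L D v (x / S)
      (x % S) (q - 2 * (b u + cnt L D v (fun _ => true) - (x / S : ℕ))) := by
    rw [blueEntry]
    split_ifs with h
    · refine ⟨fun h' => by lia, fun h' => ?_⟩
      have := (hT x hx 0 le_rfl).2 (h'.mono (by lia))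
      lia
    · constructor
      · intro h'
        have h0 := (hT x hx (T x) (by lia)).1 le_rfl
        exact h0.mono (by lia)
      · intro h'
        have := (hT x hx (max (q - 2 * (b u + cnt L D v (fun _ => true) - (x / S : ℕ))) 0)
          (by lia)).2 (h'.mono (by lia))
        lia
  rw [hT' x hx, reach_insert hu hv, newEntry, ← hblue]
  split_ifs with h
  · rw [le_max_iff]
    refine or_congr Iff.rfl ?_
    set d := 2 * (a u + (x / S - 1)) with hd
    have hS : S * (x / S) + x % S = x := Nat.div_add_mod x S
    have hSpos : 0 < S := by
      rcases Nat.eq_zero_or_pos S with h0 | h0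
      · rw [h0] at h; simp at h
      · exact h0
    have hlt := Nat.mod_lt x hSpos
    -- Since `d ≤ x % S`, moving back by `S + d` goes one row up and `d` columns left, without
    -- crossing into another row.
    have hy : x - S - d = S * (x / S - 1) + (x % S - d) := by
      have : S * (x / S) = S * (x / S - 1) + S := by
        rw [← Nat.mul_succ]; congr 1; lia
      lia
    have hdiv : (x - S - d) / S = x / S - 1 := by
      rw [hy, Nat.mul_add_div hSpos, Nat.div_eq_of_lt (a := x % S - d) (by lia), add_zero]
    have hmod : (x - S - d) % S = x % S - d := by
      rw [hy, Nat.mul_add_mod, Nat.mod_eq_of_lt (by lia)]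
    rw [hT _ (by lia) q hq, hdiv, hmod]
    exact ⟨fun h' => ⟨h.1, h.2, h'⟩, fun h' => h'.2.2⟩
  · exact ⟨.inl, fun h' => h'.elim id fun h'' => absurd ⟨h''.1, h''.2.1⟩ h⟩

/-! ### Merging groups -/

/-- The vertices that precede `k` when the groups are listed by label, up to group `v`. -/
def before (n : ℕ) (L : ℕ → ℕ) (v k : ℕ) : Finset ℕ :=
  {w ∈ range n | L w < v ∨ L w = v ∧ w < k}

theorem before_succ_of_eq {n : ℕ} {L : ℕ → ℕ} {v k : ℕ} (hk : k < n) (h : L k = v) :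
    before n L v (k + 1) = insert k (before n L v k) := by
  ext w
  simp only [before, mem_filter, mem_range, mem_insert]
  constructor
  · rintro ⟨h1, h2⟩
    by_cases hw : w = k
    · exact .inl hw
    · exact .inr ⟨h1, by lia⟩
  · rintro (rfl | ⟨h1, h2⟩)
    · exact ⟨hk, by lia⟩
    · exact ⟨h1, by lia⟩

theorem before_succ_of_ne {n : ℕ} {L : ℕ → ℕ} {v k : ℕ} (h : L k ≠ v) :
    before n L v (k + 1) = before n L v k := by
  ext w
  simp only [before, mem_filter, mem_range, and_congr_right_iff]
  intro _
  by_cases hw : w = k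
  · subst hw; lia
  · lia

theorem not_mem_before (n : ℕ) {L : ℕ → ℕ} {v k : ℕ} (h : L k = v) : k ∉ before n L v k := by
  simp [before, h]

theorem before_last (n : ℕ) (L : ℕ → ℕ) (v : ℕ) : before n L v n = before n L (v + 1) 0 := by
  ext w
  simp only [before, mem_filter, mem_range, and_congr_right_iff]
  lia

theorem before_zero (n : ℕ) (L : ℕ → ℕ) : before n L 0 0 = ∅ := by
  ext w
  simp [before]

theorem cnt_le_card (L : ℕ → ℕ) (D : Finset ℕ) (v : ℕ) (f : ℕ → Bool) : cnt L D v f ≤ #D := by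
  rw [cnt, card_eq_sum_ones]
  exact sum_le_sum fun w _ => by split_ifs <;> simp

theorem card_before_le (n : ℕ) (L : ℕ → ℕ) (v k : ℕ) : #(before n L v k) ≤ n :=
  (card_filter_le _ _).trans (card_range n).le

/-- On the empty set the count and both values are 0, so address 0 is the only reachable one. -/
theorem isTable_empty (a b L : ℕ → ℕ) {S N : ℕ} {T : ℤ → ℤ} (h0 : T 0 = 0)
    (h1 : ∀ x : ℕ, 0 < x → x < N → T x = -1) : IsTable S N T (Reach a b L ∅ 0) := by
  intro x hx q hq
  have hR : Reach a b L ∅ 0 (x / S) (x % S) q ↔ x / S = 0 ∧ x % S = 0 ∧ q ≤ 0 := by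
    constructor
    · rintro ⟨f, hf1, hf2, hf3⟩
      exact ⟨by simpa [cnt] using hf1.symm, by simpa [value] using hf2.symm,
        by simpa [value] using hf3⟩
    · rintro ⟨hx1, hx2, hx3⟩
      exact ⟨fun _ => true, by simp [cnt, hx1], by simp [value, hx2], by simpa [value] using hx3⟩
  rw [hR]
  have hx0 : x / S = 0 ∧ x % S = 0 ↔ x = 0 := by
    constructor
    · rintro ⟨h, h'⟩
      rw [← Nat.div_add_mod x S, h, h']; simp
    · rintro rfl; simp
  rw [← and_assoc, hx0]
  rcases Nat.eq_zero_or_pos x with rfl | hpos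
  · simp [h0]
  · rw [h1 x hpos hx]
    lia

/-- No vertex of `D` has the new label, so only row 0 is reachable now. Its entries are maxima over
the old rows, and rows up to `n` suffice because a count is at most `#D`. -/
theorem isTable_merge {a b L : ℕ → ℕ} {D : Finset ℕ} {v v' S n : ℕ} {T T' : ℤ → ℤ}
    (hS : 0 < S) (hD : #D ≤ n) (hv : ∀ w ∈ D, L w ≠ v')
    (hT : IsTable S ((n + 1) * S) T (Reach a b L D v))
    (h0 : ∀ p : ℕ, p < S → ∀ q : ℤ, 0 ≤ q → (q ≤ T' p ↔ ∃ i ≤ n, q ≤ T (i * S + p : ℕ)))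
    (h1 : ∀ x : ℕ, S ≤ x → x < (n + 1) * S → T' x = -1) :
    IsTable S ((n + 1) * S) T' (Reach a b L D v') := by
  have hc : ∀ f, cnt L D v' f = 0 := fun f => sum_eq_zero fun w hw => by simp [hv w hw]
  intro x hx q hq
  by_cases hxS : x < S
  · rw [h0 x hxS q hq, Nat.div_eq_of_lt hxS, Nat.mod_eq_of_lt hxS]
    have hdiv : ∀ i, (i * S + x) / S = i := fun i => by
      rw [mul_comm, Nat.mul_add_div hS, Nat.div_eq_of_lt hxS, add_zero]
    have hmod : ∀ i, (i * S + x) % S = x := fun i => by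
      rw [mul_comm, Nat.mul_add_mod, Nat.mod_eq_of_lt hxS]
    have hlt : ∀ i ≤ n, i * S + x < (n + 1) * S := fun i hi => by nlinarith
    constructor
    · rintro ⟨i, hi, hq'⟩
      rw [hT _ (hlt i hi) q hq, hdiv, hmod] at hq'
      obtain ⟨f, -, h2, h3⟩ := hq'
      exact ⟨f, hc f, h2, h3⟩
    · rintro ⟨f, -, h2, h3⟩
      have hi := (cnt_le_card L D v f).trans hD
      refine ⟨cnt L D v f, hi, ?_⟩
      rw [hT _ (hlt _ hi) q hq, hdiv, hmod]
      exact ⟨f, rfl, h2, h3⟩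
  · rw [h1 x (by lia) hx]
    refine ⟨fun h => by lia, ?_⟩
    rintro ⟨f, hf, -⟩
    have : 0 < x / S := Nat.div_pos (by lia) hS
    rw [hc] at hf
    lia

/-! ### Numbering the colorings of a set -/

/-- The number of elements of `x` below `k`. -/
def below (x : ℕ → Bool) (k : ℕ) : ℕ := ∑ v ∈ range k, if x v then 1 else 0

/-- The number whose binary digits are the values of `g` on `x`, from the least element on. -/
def code (x g : ℕ → Bool) (k : ℕ) : ℕ := ∑ v ∈ range k, if x v ∧ g v then 2 ^ below x v else 0

theorem below_succ (x : ℕ → Bool) (k : ℕ) :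
    below x (k + 1) = below x k + if x k then 1 else 0 := sum_range_succ _ _

theorem code_succ (x g : ℕ → Bool) (k : ℕ) :
    code x g (k + 1) = code x g k + if x k ∧ g k then 2 ^ below x k else 0 := sum_range_succ _ _

theorem code_lt (x g : ℕ → Bool) (k : ℕ) : code x g k < 2 ^ below x k := by
  induction k with
  | zero => simp [code, below]
  | succ k ih =>
    rw [code_succ, below_succ]
    by_cases hx : x k
    · rw [if_pos hx, pow_succ]
      split_ifs <;> lia
    · simpa [hx] using ih

theorem code_congr {x g g' : ℕ → Bool} {k : ℕ} (h : ∀ v < k, x v = true → g v = g' v) :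
    code x g k = code x g' k := by
  refine sum_congr rfl fun v hv => ?_
  by_cases hx : x v
  · rw [h v (mem_range.1 hv) hx]
  · simp [hx]

/-- By `code_lt` the lower digits cannot make up for the top one, so equal codes have the same top
digit and the same remainder. -/
theorem code_injective {x g g' : ℕ → Bool} {k : ℕ} (h : code x g k = code x g' k) :
    ∀ v < k, x v = true → g v = g' v := by
  induction k with
  | zero => intro v hv; lia
  | succ k ih =>
    rw [code_succ, code_succ] at h
    have h1 := code_lt x g k
    have h2 := code_lt x g' k
    have h3 : code x g k = code x g' k ∧ (x k = true → g k = g' k) := by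
      by_cases hx : x k
      · cases hg : g k <;> cases hg' : g' k <;> simp [hx, hg, hg'] at h ⊢ <;> lia
      · simpa [hx] using h
    intro v hv hxv
    rcases Nat.lt_succ_iff_lt_or_eq.1 hv with hv | rfl
    · exact ih h3.1 v hv hxv
    · exact h3.2 hxv

/-- Existence of the binary expansion: the top digit is found by comparing `r` with its place value.
-/
theorem exists_code_eq (x : ℕ → Bool) (k r : ℕ) (hr : r < 2 ^ below x k) :
    ∃ g, code x g k = r := by
  induction k generalizing r with
  | zero => exact ⟨fun _ => true, by simp [code, below] at hr ⊢; lia⟩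
  | succ k ih =>
    have upd : ∀ g (c : Bool), code x (Function.update g k c) k = code x g k := fun g c =>
      code_congr fun v hv _ => Function.update_of_ne (by lia) _ _
    rw [below_succ] at hr
    by_cases hx : x k
    · rw [if_pos hx, pow_succ] at hr
      by_cases h : r < 2 ^ below x k
      · obtain ⟨g, hg⟩ := ih r h
        exact ⟨Function.update g k false, by rw [code_succ, upd]; simpa using hg⟩
      · obtain ⟨g, hg⟩ := ih (r - 2 ^ below x k) (by lia)
        refine ⟨Function.update g k true, ?_⟩
        rw [code_succ, upd, hg]
        simp [hx]
        lia
    · obtain ⟨g, hg⟩ := ih r (by simpa [hx] using hr)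
      exact ⟨g, by rw [code_succ]; simpa [hx] using hg⟩

/-! ### From graphs to matrices -/

open Classical in
/-- The adjacency matrix of a graph on `{0, …, n - 1}`. -/
noncomputable def adjOf {n : ℕ} (G : SimpleGraph (Fin n)) (u w : ℕ) : Bool :=
  decide (∃ (hu : u < n) (hw : w < n), G.Adj ⟨u, hu⟩ ⟨w, hw⟩)

theorem adjOf_coe {n : ℕ} {G : SimpleGraph (Fin n)} (u w : Fin n) :
    adjOf G u w = true ↔ G.Adj u w := by simp [adjOf]

theorem adjOf_symm {n : ℕ} (G : SimpleGraph (Fin n)) (u w : ℕ) : adjOf G u w = adjOf G w u := by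
  simp only [adjOf, decide_eq_decide]
  exact ⟨fun ⟨h, h', a⟩ => ⟨h', h, a.symm⟩, fun ⟨h, h', a⟩ => ⟨h', h, a.symm⟩⟩

open Classical in
-- The degree sum formula for the subgraph `H` of edges with both ends of color `c`.
theorem two_mul_monoEdges {n : ℕ} (G : SimpleGraph (Fin n)) (f : Fin n → Color) (c : Color)
    (g : ℕ → Bool) (hg : ∀ u : Fin n, g u = true ↔ f u = c) :
    2 * monoEdges G f c = pairs n (adjOf G) g := by
  let H : SimpleGraph (Fin n) :=
    { Adj := fun u w => G.Adj u w ∧ f u = c ∧ f w = c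
      symm := ⟨fun u w h => ⟨h.1.symm, h.2.2, h.2.1⟩⟩
      loopless := ⟨fun u h => G.loopless.irrefl u h.1⟩ }
  have h1 : {e ∈ G.edgeSet | ∀ v ∈ e, f v = c} = H.edgeSet := by
    ext e
    induction e with
    | _ u w => simp [H, SimpleGraph.mem_edgeSet]
  rw [monoEdges, h1, ← SimpleGraph.coe_edgeFinset, Set.ncard_coe_finset,
    ← SimpleGraph.sum_degrees_eq_twice_card_edges, pairs, ← Fin.sum_univ_eq_sum_range
      (fun u => ∑ w ∈ range n, if adjOf G u w ∧ g u ∧ g w then 1 else 0) n]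
  refine sum_congr rfl fun u _ => ?_
  rw [← Fin.sum_univ_eq_sum_range (fun w => if adjOf G u w ∧ g u ∧ g w then 1 else 0) n,
    ← SimpleGraph.card_neighborFinset_eq_degree, SimpleGraph.neighborFinset_eq_filter, card_filter]
  refine sum_congr rfl fun w _ => ?_
  simp only [adjOf_coe, hg]
  rfl

theorem pairs_true {n : ℕ} (G : SimpleGraph (Fin n)) :
    pairs n (adjOf G) (fun _ => true) = 2 * G.edgeSet.ncard := by
  rw [← two_mul_monoEdges G (fun _ => Color.red) Color.red (fun _ => true) (by simp)]
  simp [monoEdges]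

theorem hasLoadColoring_iff {n : ℕ} (G : SimpleGraph (Fin n)) (k₁ k₂ : ℤ) :
    HasLoadColoring G k₁ k₂ ↔ ∃ g : ℕ → Bool, 2 * k₁ ≤ pairs n (adjOf G) g ∧
      2 * k₂ ≤ pairs n (adjOf G) (fun u => !g u) := by
  classical
  constructor
  · rintro ⟨f, h1, h2⟩
    refine ⟨fun u => decide (∃ hu : u < n, f ⟨u, hu⟩ = Color.red), ?_, ?_⟩
    · rw [← two_mul_monoEdges G f Color.red _ (by simp)]
      push_cast; lia
    · rw [← two_mul_monoEdges G f Color.blue _ (fun u => by cases h : f u <;> simp [h])]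
      push_cast; lia
  · rintro ⟨g, h1, h2⟩
    refine ⟨fun u => if g u then Color.red else Color.blue, ?_, ?_⟩
    · rw [← two_mul_monoEdges G (fun u => if g u then Color.red else Color.blue) Color.red g
        (fun u => by cases h : g u <;> simp)] at h1
      push_cast at h1; lia
    · rw [← two_mul_monoEdges G (fun u => if g u then Color.red else Color.blue) Color.blue _
        (fun u => by cases h : g u <;> simp)] at h2
      push_cast at h2; lia

namespace LoopProg

/-! ### Preparations

Registers: `0` holds `n`, `1` and `2` the required numbers of edges, `3`, `4`, `5` the constants
`1`, `0`, `-1`, `7` and `8` the width and the size of the table, `9` the number of colorings of the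
deletion set, `10` the answer, `16` the size of the current group, `17` and `18` twice the numbers
of red and blue edges inside the deletion set; `11`, `12`, `13`, `14` are loop variables.

Arrays: `0` holds the adjacency matrix, `1` the deletion set, `2` the row addresses, `3` the labels,
`4` and `5` the red and blue part of the deletion set, `6` and `7` the numbers of red and blue
neighbors, `8` and `9` the table, `10` and `11` the row and column of each table address, `12` the
place values for numbering the colorings. -/

/-- The state holds a graph on `{0, …, n - 1}` and a vertex set, some constants, and the addresses
of the rows of the adjacency matrix. -/
structure Input (n : ℕ) (adj : ℕ → ℕ → Bool) (s : State) : Prop where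
  reg_n : s.reg 0 = n
  one : s.reg 3 = 1
  zero : s.reg 4 = 0
  neg : s.reg 5 = -1
  entries : ∀ u < n, ∀ w < n, s.mem 0 (u * n + w) = if adj u w then 1 else 0
  rows : ∀ u < n, s.mem 2 u = u * n

theorem Input.frame {n : ℕ} {adj : ℕ → ℕ → Bool} {s s' : State} {p : LoopProg}
    (h : Input n adj s) (hF : p.Frame s s') (hp : keepsAll [0, 3, 4, 5] [0, 2] p = true) :
    Input n adj s' := by
  obtain ⟨hr, hm⟩ := hF.of_keepsAll hp
  simp only [List.mem_cons, List.not_mem_nil, or_false, forall_eq_or_imp, forall_eq] at hr hm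
  exact ⟨by rw [hr.1, h.reg_n], by rw [hr.2.1, h.one], by rw [hr.2.2.1, h.zero],
    by rw [hr.2.2.2, h.neg], by rw [hm.1]; exact h.entries, by rw [hm.2]; exact h.rows⟩

/-- The vertex set `x` is stored in array `1`. -/
def HoldsSet (n : ℕ) (x : ℕ → Bool) (s : State) : Prop :=
  ∀ u < n, s.mem 1 u = if x u then 1 else 0

/-- Constants and row addresses. -/
def constants : LoopProg :=
  const 4 0 ;; const 5 (-1) ;; const 15 0 ;; loop 12 0 (store 2 12 15 ;; add 15 15 0)

/-- The machine cannot multiply, so the row addresses `u * n` are tabulated by repeated addition. -/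
theorem constants_spec {n : ℕ} {adj : ℕ → ℕ → Bool} {s : State} (hn : s.reg 0 = n)
    (h3 : s.reg 3 = 1)
    (hadj : ∀ u < n, ∀ w < n, s.mem 0 (u * n + w) = if adj u w then 1 else 0) :
    Input n adj (constants.run s) := by
  have key := loop_induction (r := 12) (b := 0) (p := store 2 12 15 ;; add 15 15 0)
    (s := ((s.set 4 0).set 5 (-1)).set 15 0) (N := n) (by simp [hn])
    (fun k s' => s'.reg 15 = k * n ∧ ∀ u < k, s'.mem 2 u = u * n) (by simp) (by
      intro k hk s' hF hr ⟨h1, h2⟩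
      have h0 : s'.reg 0 = n := by rw [hF.reg 0 rfl]; simp [hn]
      refine ⟨by simp [h1, h0]; ring, fun u hu => ?_⟩
      simp only [run_seq, run_store, run_add, State.mem_set, State.mem_put, hr, h1, if_true,
        Nat.cast_inj]
      split_ifs with h
      · rw [h]
      · exact h2 u (by lia))
  have hF := frame_run constants s
  have hF' := frame_run (loop 12 0 (store 2 12 15 ;; add 15 15 0))
    (((s.set 4 0).set 5 (-1)).set 15 0)
  exact ⟨by rw [hF.reg 0 rfl, hn], by rw [hF.reg 3 rfl, h3],
    by rw [constants]; exact (hF'.reg 4 rfl).trans (by simp),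
    by rw [constants]; exact (hF'.reg 5 rfl).trans (by simp),
    by rw [hF.mem 0 rfl]; exact hadj, key.2⟩

/-- Register `7` becomes the number of ones of the adjacency matrix plus one. -/
def tableWidth : LoopProg :=
  const 7 1 ;; loop 12 0 (loop 13 0 (entry 20 12 13 ;; add 7 7 20))

theorem Input.mem_entry {n : ℕ} {adj : ℕ → ℕ → Bool} {s : State} (h : Input n adj s) {u w : ℕ}
    (hu : u < n) (hw : w < n) {x y : ℤ} (hx : x = u) (hy : y = w) :
    s.mem 0 (s.mem 2 x + y) = if adj u w then 1 else 0 := by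
  rw [hx, hy, h.rows u hu, h.entries u hu w hw]

/-- The width is one more than the number of ordered adjacent pairs, so every red value from 0 up to
that number has a column (`value_le`). -/
theorem tableWidth_spec {n : ℕ} {adj : ℕ → ℕ → Bool} {s : State} (h : Input n adj s) :
    (tableWidth.run s).reg 7 = (pairs n adj (fun _ => true) + 1 : ℕ) := by
  have key := loop_induction (r := 12) (b := 0) (p := loop 13 0 (entry 20 12 13 ;; add 7 7 20))
    (s := s.set 7 1) (N := n) (by simp [h.reg_n])
    (fun k s' => s'.reg 7 = (∑ u ∈ range k, ∑ w ∈ range n,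
      (if adj u w then 1 else 0) + 1 : ℕ)) (by simp) (by
      intro k hk s' hF hr h1
      have hi : Input n adj s' :=
        (h.frame (frame_run (const 7 1) s) rfl).frame hF rfl
      have inner := loop_induction (r := 13) (b := 0) (p := entry 20 12 13 ;; add 7 7 20)
        (s := s') (N := n) hi.reg_n
        (fun j s' => s'.reg 7 = (∑ u ∈ range k, ∑ w ∈ range n,
          (if adj u w then 1 else 0) + ∑ w ∈ range j, (if adj k w then 1 else 0) + 1 : ℕ))
        (by simpa using h1) (by
          intro j hj s'' hF' hr' h2
          have hi' := hi.frame hF' rfl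
          have h12 : s''.reg 12 = k := by rw [hF'.reg 12 rfl, hr]
          have he := hi'.mem_entry hk hj h12 hr'
          simp only [entry, run_seq, run_load, run_add, State.reg_set, State.mem_set]
          simp only [Nat.reduceEqDiff, if_false, if_true, he, h2, sum_range_succ]
          push_cast; ring)
      rw [State.reg_set, if_neg (by decide), inner, sum_range_succ])
  refine key.trans ?_
  simp [pairs]

/-- Register `8` becomes `n + 1` times register `7`. -/
def tableSize : LoopProg := add 8 7 4 ;; loop 12 0 (add 8 8 7)

theorem tableSize_spec {n S : ℕ} {adj : ℕ → ℕ → Bool} {s : State} (h : Input n adj s)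
    (hS : s.reg 7 = S) : (tableSize.run s).reg 8 = ((n + 1) * S : ℕ) := by
  refine loop_induction (r := 12) (b := 0) (p := add 8 8 7)
    (s := s.set 8 (s.reg 7 + s.reg 4)) (N := n) (by simp [h.reg_n])
    (fun k s' => s'.reg 8 = ((k + 1) * S : ℕ)) (by simp [hS, h.zero]) ?_
  intro k hk s' hF hr h1
  have h7 : s'.reg 7 = S := by rw [hF.reg 7 rfl]; simp [hS]
  simp [h1, h7]; ring

/-- Register `9` becomes `2` to the size of the given vertex set, and array `12` holds for each of
its elements `2` to the number of smaller elements. -/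
def powers : LoopProg :=
  const 9 1 ;; loop 12 0 (store 12 12 9 ;; load 20 1 12 ;; ifLt 4 20 (add 9 9 9) skip)

theorem powers_spec {n : ℕ} {adj : ℕ → ℕ → Bool} {x : ℕ → Bool} {s : State} (h : Input n adj s)
    (hx : HoldsSet n x s) :
    (powers.run s).reg 9 = (2 ^ below x n : ℕ) ∧
      ∀ v < n, (powers.run s).mem 12 v = (2 ^ below x v : ℕ) := by
  refine loop_induction (r := 12) (b := 0)
    (p := store 12 12 9 ;; load 20 1 12 ;; ifLt 4 20 (add 9 9 9) skip)
    (s := s.set 9 1) (N := n) (by simp [h.reg_n])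
    (fun k s' => s'.reg 9 = (2 ^ below x k : ℕ) ∧
      ∀ v < k, s'.mem 12 v = (2 ^ below x v : ℕ)) (by simp [below]) ?_
  intro k hk s' hF hr ⟨h1, h2⟩
  have h4 : s'.reg 4 = 0 := by rw [hF.reg 4 rfl]; simp [h.zero]
  have hxk : s'.mem 1 k = if x k then 1 else 0 := by rw [hF.mem 1 rfl]; exact hx k hk
  have h3 : ∀ v < k + 1, (if (v : ℤ) = k then ((2 ^ below x k : ℕ) : ℤ) else s'.mem 12 v) =
      (2 ^ below x v : ℕ) := by
    intro v hv
    split_ifs with h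
    · rw [Nat.cast_inj.1 h]
    · exact h2 v (by lia)
  by_cases hxk' : x k
  · refine ⟨?_, fun v hv => ?_⟩
    · simp [hr, hxk, hxk', h4, h1, below_succ, pow_succ]; ring
    · refine Eq.trans ?_ (h3 v hv)
      simp [hr, hxk, hxk', h4, h1]
  · refine ⟨?_, fun v hv => ?_⟩
    · simp [hr, hxk, hxk', h4, h1, below_succ]
    · refine Eq.trans ?_ (h3 v hv)
      simp [hr, hxk, hxk', h4, h1]

/-- Label every vertex outside the given set by its largest neighbor outside the set or, if that is
larger, by itself, and label the vertices of the set by `n`. -/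
def labels : LoopProg :=
  loop 12 0 (load 20 1 12 ;; ifLt 4 20 (store 3 12 0)
    (store 3 12 12 ;; loop 13 0 (ifLt 12 13 (load 21 1 13 ;; ifLt 4 21 skip
      (entry 22 12 13 ;; ifLt 4 22 (store 3 12 13) skip)) skip)))

/-- The labels that `labels` computes, when only neighbors below `k` are considered. -/
def labelBelow (adj : ℕ → ℕ → Bool) (x : ℕ → Bool) (u : ℕ) : ℕ → ℕ
  | 0 => u
  | k + 1 => if u < k ∧ x k = false ∧ adj u k then k else labelBelow adj x u k

/-- The labels that `labels` computes. -/
def label (n : ℕ) (adj : ℕ → ℕ → Bool) (x : ℕ → Bool) (u : ℕ) : ℕ :=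
  if x u then n else labelBelow adj x u n

theorem labels_spec {n : ℕ} {adj : ℕ → ℕ → Bool} {x : ℕ → Bool} {s : State} (h : Input n adj s)
    (hx : HoldsSet n x s) : ∀ u < n, (labels.run s).mem 3 u = label n adj x u := by
  refine loop_induction (r := 12) (b := 0) (N := n) h.reg_n
    (fun k s' => ∀ u < k, s'.mem 3 u = label n adj x u) (by simp) ?_
  intro k hk s' hF hr h1
  have hi := h.frame hF rfl
  have hx' : HoldsSet n x s' := fun u hu => by rw [hF.mem 1 rfl]; exact hx u hu
  have hxk : s'.mem 1 k = if x k then 1 else 0 := hx' k hk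
  intro u hu
  by_cases hxk' : x k
  · simp [hxk, hxk', hi.zero, hr, hi.reg_n]
    split_ifs with h
    · rw [h, label, if_pos hxk']
    · exact h1 u (by lia)
  · have inner := loop_induction (r := 13) (b := 0) (p := ifLt 12 13 (load 21 1 13 ;;
        ifLt 4 21 skip (entry 22 12 13 ;; ifLt 4 22 (store 3 12 13) skip)) skip)
      (s := (s'.set 20 0).put 3 k k) (N := n) (by simp [hi.reg_n])
      (fun j s'' => s''.mem 3 k = labelBelow adj x k j ∧ ∀ u < k, s''.mem 3 u = s'.mem 3 u)
      ⟨by simp [labelBelow], fun u hu => by simp; lia⟩ (by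
        intro j hj s'' hF' hr' ⟨h2, h3⟩
        have hi' : Input n adj s'' := by
          have hi1 : Input n adj (s'.set 20 0) := hi.frame (frame_run (const 20 0) s') rfl
          have hi2 := hi1.frame (frame_run (store 3 12 12) (s'.set 20 0)) rfl
          have hput : (store 3 12 12).run (s'.set 20 0) = (s'.set 20 0).put 3 k k := by simp [hr]
          exact (hput ▸ hi2).frame hF' rfl
        have hxj : s''.mem 1 j = if x j then 1 else 0 := by
          rw [hF'.mem 1 rfl]; simpa using hx' j hj
        have h12 : s''.reg 12 = k := by rw [hF'.reg 12 rfl]; simp [hr]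
        have he := hi'.mem_entry hk hj rfl rfl
        have he' : s''.mem 0 (s''.mem 2 k + j) = if adj k j then 1 else 0 := he
        by_cases hkj : k < j
        · by_cases hxj' : x j
          · simpa [h12, hr', hkj, hxj, hxj', hi'.zero, labelBelow] using ⟨h2, h3⟩
          · by_cases ha : adj k j
            · simp [h12, hr', hkj, hxj, hxj', hi'.zero, labelBelow, entry, he', ha]
              intro u hu
              rw [if_neg (by lia), h3 u hu]
            · simpa [h12, hr', hkj, hxj, hxj', hi'.zero, labelBelow, entry, he', ha]
                using ⟨h2, h3⟩
        · simpa [h12, hr', hkj, labelBelow] using ⟨h2, h3⟩)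
    have hrun : (load 20 1 12 ;; ifLt 4 20 (store 3 12 0)
        (store 3 12 12 ;; loop 13 0 (ifLt 12 13 (load 21 1 13 ;; ifLt 4 21 skip
        (entry 22 12 13 ;; ifLt 4 22 (store 3 12 13) skip)) skip))).run s' =
        (loop 13 0 (ifLt 12 13 (load 21 1 13 ;; ifLt 4 21 skip
        (entry 22 12 13 ;; ifLt 4 22 (store 3 12 13) skip)) skip)).run
          ((s'.set 20 0).put 3 k k) := by
      simp [hxk, hxk', hi.zero, hr]
    rw [hrun, State.mem_set]
    rcases Nat.lt_succ_iff_lt_or_eq.1 hu with hu | rfl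
    · rw [inner.2 u hu, h1 u hu]
    · rw [inner.1, label, if_neg hxk']

/-- Arrays `10` and `11` hold the row and the column of each table address. -/
def indices : LoopProg :=
  const 20 0 ;; const 21 0 ;; loop 14 8 (store 10 14 20 ;; store 11 14 21 ;; add 21 21 3 ;;
    ifLt 21 7 skip (const 21 0 ;; add 20 20 3))

/-- Division by counting: the column counter wraps around at `S` and then advances the row counter.
-/
theorem indices_spec {S N : ℕ} {s : State} (hS : s.reg 7 = S) (hpos : 0 < S) (hN : s.reg 8 = N)
    (h3 : s.reg 3 = 1) :
    ∀ y < N, (indices.run s).mem 10 y = (y / S : ℕ) ∧ (indices.run s).mem 11 y = (y % S : ℕ) := by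
  have key := loop_induction (r := 14) (b := 8) (p := store 10 14 20 ;; store 11 14 21 ;;
      add 21 21 3 ;; ifLt 21 7 skip (const 21 0 ;; add 20 20 3))
    (s := (s.set 20 0).set 21 0) (N := N) (by simp [hN])
    (fun k s' => (s'.reg 20 = (k / S : ℕ) ∧ s'.reg 21 = (k % S : ℕ)) ∧
      ∀ y < k, s'.mem 10 y = (y / S : ℕ) ∧ s'.mem 11 y = (y % S : ℕ)) (by simp) (by
    intro k hk s' hF hr ⟨⟨h1, h2⟩, h4⟩
    have h3' : s'.reg 3 = 1 := by rw [hF.reg 3 rfl]; simp [h3]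
    have h7 : s'.reg 7 = S := by rw [hF.reg 7 rfl]; simp [hS]
    have hlt := Nat.mod_lt k hpos
    have h5 : ∀ y < k + 1,
        (if (y : ℤ) = k then ((k / S : ℕ) : ℤ) else s'.mem 10 y) = (y / S : ℕ) ∧
        (if (y : ℤ) = k then ((k % S : ℕ) : ℤ) else s'.mem 11 y) = (y % S : ℕ) := by
      intro y hy
      split_ifs with h
      · rw [Nat.cast_inj.1 h]; simp
      · exact h4 y (by lia)
    have hdm := Nat.div_add_mod k S
    by_cases hc : k % S + 1 < S
    · have hd : (k + 1) / S = k / S ∧ (k + 1) % S = k % S + 1 := by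
        have : k + 1 = S * (k / S) + (k % S + 1) := by lia
        rw [this, Nat.mul_add_div hpos, Nat.mul_add_mod, Nat.div_eq_of_lt hc, Nat.mod_eq_of_lt hc]
        exact ⟨rfl, rfl⟩
      have hc' : ((k % S : ℕ) : ℤ) + 1 < S := by exact_mod_cast hc
      rw [hd.1, hd.2]
      refine ⟨?_, ?_⟩
      · simp only [run_seq, run_store, run_add, run_ifLt, State.reg_set, State.reg_put, h2, h3',
          h7, Nat.reduceEqDiff, if_true, if_false, hc', run_skip, h1]
        simp
      · simp only [run_seq, run_store, run_add, run_ifLt, State.reg_set, State.reg_put, h2, h3',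
          h7, Nat.reduceEqDiff, if_true, if_false, hc', run_skip, h1, State.mem_set,
          State.mem_put, hr]
        exact h5
    · have hd : (k + 1) / S = k / S + 1 ∧ (k + 1) % S = 0 := by
        have : k + 1 = S * (k / S + 1) := by rw [Nat.mul_succ]; lia
        rw [this, Nat.mul_div_cancel_left _ hpos, Nat.mul_mod_right]
        exact ⟨rfl, rfl⟩
      have hc' : ¬ ((k % S : ℕ) : ℤ) + 1 < S := by exact_mod_cast hc
      rw [hd.1, hd.2]
      refine ⟨?_, ?_⟩
      · simp only [run_seq, run_store, run_add, run_ifLt, State.reg_set, State.reg_put, h2, h3',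
          h7, Nat.reduceEqDiff, if_true, if_false, hc', run_const, h1]
        simp
      · simp only [run_seq, run_store, run_add, run_ifLt, State.reg_set, State.reg_put, h2, h3',
          h7, Nat.reduceEqDiff, if_true, if_false, hc', run_const, h1, State.mem_set,
          State.mem_put, hr]
        exact h5)
  exact key.2

/-! ### The dynamic program for one coloring of the deletion set -/

/-- The state that the preparations lead to. -/
structure Ready (n : ℕ) (adj : ℕ → ℕ → Bool) (x : ℕ → Bool) (L : ℕ → ℕ) (S : ℕ) (s : State) : Prop
    extends Input n adj s where
  set : HoldsSet n x s
  width : s.reg 7 = S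
  size : s.reg 8 = ((n + 1) * S : ℕ)
  colorings : s.reg 9 = (2 ^ below x n : ℕ)
  labels : ∀ u < n, s.mem 3 u = L u
  indices : ∀ y < (n + 1) * S, s.mem 10 y = (y / S : ℕ) ∧ s.mem 11 y = (y % S : ℕ)
  powers : ∀ v < n, s.mem 12 v = (2 ^ below x v : ℕ)

theorem Ready.frame {n : ℕ} {adj : ℕ → ℕ → Bool} {x : ℕ → Bool} {L : ℕ → ℕ} {S : ℕ}
    {s s' : State} {p : LoopProg} (h : Ready n adj x L S s) (hF : p.Frame s s')
    (hp : keepsAll [0, 3, 4, 5, 7, 8, 9] [0, 1, 2, 3, 10, 11, 12] p = true) :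
    Ready n adj x L S s' := by
  obtain ⟨hr, hm⟩ := hF.of_keepsAll hp
  simp only [List.mem_cons, List.not_mem_nil, or_false, forall_eq_or_imp, forall_eq] at hr hm
  obtain ⟨r0, r3, r4, r5, r7, r8, r9⟩ := hr
  obtain ⟨m0, m1, m2, m3, m10, m11, m12⟩ := hm
  exact ⟨⟨r0.trans h.reg_n, r3.trans h.one, r4.trans h.zero, r5.trans h.neg,
    by rw [m0]; exact h.entries, by rw [m2]; exact h.rows⟩,
    by rw [HoldsSet, m1]; exact h.set, r7.trans h.width, r8.trans h.size, r9.trans h.colorings,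
    by rw [m3]; exact h.labels, by rw [m10, m11]; exact h.indices, by rw [m12]; exact h.powers⟩

/-- Arrays `4` and `5` hold the sets of red and blue elements of `x`. -/
def HoldsColoring (n : ℕ) (x g : ℕ → Bool) (s : State) : Prop :=
  ∀ v < n, (s.mem 4 v = if x v ∧ g v then 1 else 0) ∧ s.mem 5 v = if x v ∧ !g v then 1 else 0

/-- Write the coloring with the number in register `11`. -/
def decode : LoopProg :=
  add 15 11 4 ;; loop 12 0 (sub 20 0 12 ;; sub 20 20 3 ;; load 21 1 20 ;; load 22 12 20 ;;
    store 4 20 4 ;; store 5 20 4 ;; ifLt 4 21 (ifLt 15 22 (store 5 20 3)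
      (store 4 20 3 ;; sub 15 15 22)) skip)

/-- Digits are extracted from the greatest vertex down. By `code_lt`, a digit is 1 exactly when the
remaining number is at least its place value, so comparison and subtraction suffice. -/
theorem decode_spec {n : ℕ} {adj : ℕ → ℕ → Bool} {x : ℕ → Bool} {L : ℕ → ℕ} {S : ℕ}
    {s : State} (h : Ready n adj x L S s) {g : ℕ → Bool} (hg : s.reg 11 = code x g n) :
    HoldsColoring n x g (decode.run s) := by
  have key := loop_induction (r := 12) (b := 0) (p := sub 20 0 12 ;; sub 20 20 3 ;;
      load 21 1 20 ;; load 22 12 20 ;;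
      store 4 20 4 ;; store 5 20 4 ;; ifLt 4 21 (ifLt 15 22 (store 5 20 3)
      (store 4 20 3 ;; sub 15 15 22)) skip)
    (s := s.set 15 (s.reg 11 + s.reg 4)) (N := n) (by simp [h.reg_n])
    (fun k s' => s'.reg 15 = code x g (n - k) ∧ ∀ v < n, n - k ≤ v →
      (s'.mem 4 v = if x v ∧ g v then 1 else 0) ∧ s'.mem 5 v = if x v ∧ !g v then 1 else 0)
    ⟨by simp [hg, h.zero], fun v hv hv' => by lia⟩ (by
      intro k hk s' hF hr ⟨h1, h2⟩
      have hR : Ready n adj x L S s' :=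
        (h.frame (frame_run (add 15 11 4) s) rfl).frame hF rfl
      -- Round `k` treats the vertex `j = n - 1 - k`.
      obtain ⟨j, hj⟩ : ∃ j, n - k = j + 1 := ⟨n - k - 1, by lia⟩
      have hj' : n - (k + 1) = j := by lia
      have hjn : j < n := by lia
      have hxj := hR.set j hjn
      have hpj := hR.powers j hjn
      have hlt := code_lt x g j
      rw [hj, code_succ] at h1
      rw [hj']
      rw [hj] at h2
      have hv : ∀ v < n, j ≤ v → v = j ∨ (v ≠ j ∧ j + 1 ≤ v) := by lia
      have haddr' : (n : ℤ) - k - 1 = j := by lia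
      have hlt' : ((code x g j : ℕ) : ℤ) < 2 ^ below x j := by exact_mod_cast hlt
      by_cases hx : x j
      · cases hgj : g j
        · have h1' : s'.reg 15 = code x g j := by simpa [hgj] using h1
          refine ⟨?_, fun v hvn hjv => ?_⟩
          · simp [hR.reg_n, hr, hR.one, haddr', hxj, hx, hpj, hR.zero, h1', hlt']
          · rcases hv v hvn hjv with rfl | ⟨hne, hle⟩
            · simp [hR.reg_n, hr, hR.one, haddr', hxj, hx, hpj, hR.zero, h1', hlt', hgj]
            · simpa [hR.reg_n, hr, hR.one, haddr', hxj, hx, hpj, hR.zero, h1', hlt', hne]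
                using h2 v hvn hle
        · have h1' : s'.reg 15 = code x g j + 2 ^ below x j := by simpa [hgj, hx] using h1
          have hn : ¬ ((code x g j : ℕ) : ℤ) < 0 := by lia
          refine ⟨?_, fun v hvn hjv => ?_⟩
          · simp [hR.reg_n, hr, hR.one, haddr', hxj, hx, hpj, hR.zero, h1', hn]
          · rcases hv v hvn hjv with rfl | ⟨hne, hle⟩
            · simp [hR.reg_n, hr, hR.one, haddr', hxj, hx, hpj, hR.zero, h1', hn, hgj]
            · simpa [hR.reg_n, hr, hR.one, haddr', hxj, hx, hpj, hR.zero, h1', hn, hne]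
                using h2 v hvn hle
      · have h1' : s'.reg 15 = code x g j := by simpa [hx] using h1
        refine ⟨?_, fun v hvn hjv => ?_⟩
        · simp [hR.reg_n, hr, hR.one, haddr', hxj, hx, hR.zero, h1']
        · rcases hv v hvn hjv with rfl | ⟨hne, hle⟩
          · simp [hR.reg_n, hr, hR.one, haddr', hxj, hx, hR.zero]
          · simpa [hR.reg_n, hr, hR.one, haddr', hxj, hx, hR.zero, hne] using h2 v hvn hle)
  intro v hv
  exact key.2 v hv (by lia)

/-- Arrays `6` and `7` become the numbers of red and blue neighbors in `x`. -/
def weights : LoopProg :=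
  loop 12 0 (const 20 0 ;; const 21 0 ;; loop 13 0 (entry 22 12 13 ;; ifLt 4 22
    (load 23 4 13 ;; add 20 20 23 ;; load 23 5 13 ;; add 21 21 23) skip) ;;
    store 6 12 20 ;; store 7 12 21)

theorem weights_spec {n : ℕ} {adj : ℕ → ℕ → Bool} {x g : ℕ → Bool} {s : State}
    (h : Input n adj s) (hg : HoldsColoring n x g s) :
    ∀ u < n, (weights.run s).mem 6 u = nbrs n adj x g u ∧
      (weights.run s).mem 7 u = nbrs n adj x (fun w => !g w) u := by
  refine loop_induction (r := 12) (b := 0) (N := n) h.reg_n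
    (fun k s' => ∀ u < k, s'.mem 6 u = nbrs n adj x g u ∧
      s'.mem 7 u = nbrs n adj x (fun w => !g w) u) (by simp) ?_
  intro k hk s' hF hr h1
  have hi := h.frame hF rfl
  have inner := loop_induction (r := 13) (b := 0) (p := entry 22 12 13 ;; ifLt 4 22
      (load 23 4 13 ;; add 20 20 23 ;; load 23 5 13 ;; add 21 21 23) skip)
    (s := (s'.set 20 0).set 21 0) (N := n) (by simp [hi.reg_n])
    (fun j s'' => s''.reg 20 = (∑ w ∈ range j, if adj k w ∧ x w ∧ g w then 1 else 0 : ℕ) ∧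
      s''.reg 21 = (∑ w ∈ range j, if adj k w ∧ x w ∧ !g w then 1 else 0 : ℕ))
    (by simp) (by
      intro j hj s'' hF' hr' ⟨h2, h3⟩
      have hi' : Input n adj s'' :=
        (hi.frame (frame_run (const 20 0 ;; const 21 0) s') rfl).frame hF' rfl
      have h12 : s''.reg 12 = k := by rw [hF'.reg 12 rfl]; simp [hr]
      have he' : s''.mem 0 (s''.mem 2 k + j) = if adj k j then 1 else 0 :=
        hi'.mem_entry hk hj rfl rfl
      have h45 : (s''.mem 4 j = if x j ∧ g j then 1 else 0) ∧
          s''.mem 5 j = if x j ∧ !g j then 1 else 0 := by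
        rw [hF'.mem 4 rfl, hF'.mem 5 rfl, State.mem_set, State.mem_set, hF.mem 4 rfl,
          hF.mem 5 rfl]
        exact hg j hj
      rw [sum_range_succ, sum_range_succ]
      by_cases ha : adj k j
      · simp [h12, hr', entry, he', ha, hi'.zero, h45.1, h45.2, h2, h3]
      · simp [h12, hr', entry, he', ha, hi'.zero, h2, h3])
  have hF' := frame_run (loop 13 0 (entry 22 12 13 ;; ifLt 4 22
      (load 23 4 13 ;; add 20 20 23 ;; load 23 5 13 ;; add 21 21 23) skip))
    ((s'.set 20 0).set 21 0)
  have h12 := hF'.reg 12 rfl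
  have h6 := hF'.mem 6 rfl
  have h7 := hF'.mem 7 rfl
  intro u hu
  simp only [run_seq, run_const, run_store, State.mem_set, State.mem_put, State.reg_put, h12,
    State.reg_set, hr, inner.1, inner.2, h6, h7, Nat.reduceEqDiff, if_true, if_false,
    Nat.cast_inj]
  split_ifs with hc
  · subst hc; exact ⟨rfl, rfl⟩
  · exact h1 u (by lia)

/-- Registers `17` and `18` become twice the numbers of red and blue edges inside `x`. -/
def inside : LoopProg :=
  const 17 0 ;; const 18 0 ;; loop 12 0 (load 20 4 12 ;; load 21 6 12 ;;
    ifLt 4 20 (add 17 17 21) skip ;; load 20 5 12 ;; load 21 7 12 ;;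
    ifLt 4 20 (add 18 18 21) skip)

/-- The neighbor counts are available for the vertices of `x` too; summed over its red ones they
count each red edge inside `x` twice, and likewise for blue. -/
theorem inside_spec {n : ℕ} {adj : ℕ → ℕ → Bool} {x g : ℕ → Bool} {s : State}
    (h : Input n adj s) (hg : HoldsColoring n x g s)
    (hw : ∀ u < n, s.mem 6 u = nbrs n adj x g u ∧ s.mem 7 u = nbrs n adj x (fun w => !g w) u) :
    (inside.run s).reg 17 = base n adj x g ∧
      (inside.run s).reg 18 = base n adj x (fun w => !g w) := by
  refine loop_induction (r := 12) (b := 0) (p := load 20 4 12 ;; load 21 6 12 ;;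
      ifLt 4 20 (add 17 17 21) skip ;; load 20 5 12 ;; load 21 7 12 ;;
      ifLt 4 20 (add 18 18 21) skip) (s := (s.set 17 0).set 18 0) (N := n) (by simp [h.reg_n])
    (fun k s' => s'.reg 17 = (∑ u ∈ range k, if x u ∧ g u then nbrs n adj x g u else 0 : ℕ) ∧
      s'.reg 18 = (∑ u ∈ range k, if x u ∧ !g u then nbrs n adj x (fun w => !g w) u else 0 : ℕ))
    (by simp) ?_
  intro k hk s' hF hr ⟨h1, h2⟩
  have h4 : s'.reg 4 = 0 := by rw [hF.reg 4 rfl]; simp [h.zero]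
  have hg' := hg k hk
  have hw' := hw k hk
  rw [← State.mem_set s 17 0, ← State.mem_set _ 18 0, ← hF.mem 4 rfl, ← hF.mem 5 rfl] at hg'
  rw [← State.mem_set s 17 0, ← State.mem_set _ 18 0, ← hF.mem 6 rfl, ← hF.mem 7 rfl] at hw'
  rw [sum_range_succ, sum_range_succ]
  by_cases hx : x k <;> cases hgk : g k <;>
    simp [hr, hg'.1, hg'.2, hw'.1, hw'.2, h4, hx, hgk, h1, h2]

/-- Initialize the table. -/
def initTable : LoopProg := loop 14 8 (store 8 14 5) ;; store 8 4 4

theorem initTable_spec {n S : ℕ} {adj : ℕ → ℕ → Bool} {x : ℕ → Bool} {L : ℕ → ℕ} {s : State}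
    (h : Ready n adj x L S s) (a b : ℕ → ℕ) :
    IsTable S ((n + 1) * S) ((initTable.run s).mem 8) (Reach a b L ∅ 0) := by
  have key := loop_induction (r := 14) (b := 8) (p := store 8 14 5) (s := s) h.size
    (fun k s' => ∀ y < k, s'.mem 8 y = -1) (by simp) (by
      intro k hk s' hF hr h1 y hy
      have h5 := (h.frame hF rfl).neg
      simp only [run_store, State.mem_set, State.mem_put, hr, h5, if_true, Nat.cast_inj]
      split_ifs with hc
      · rfl
      · exact h1 y (by lia))
  have h4 := (h.frame (frame_run (loop 14 8 (store 8 14 5)) s) rfl).zero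
  refine isTable_empty a b L ?_ fun y h0 hy => ?_
  · simp [initTable, h4]
  · have hne : (y : ℤ) ≠ 0 := by lia
    simp only [initTable, run_seq, run_store, State.mem_put, h4, if_true, if_neg hne]
    exact key y hy

/-- Compute in array `9` the new entry at the address in register `14`. -/
def updateEntry : LoopProg :=
  load 24 10 14 ;; load 25 11 14 ;; load 26 8 14 ;;
    ifLt 26 4 (const 27 (-1)) (sub 28 16 24 ;; add 28 28 31 ;; add 27 26 28 ;; add 27 27 28) ;;
    ifLt 4 24 (add 28 30 24 ;; sub 28 28 3 ;; add 28 28 28 ;;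
      ifLt 25 28 skip (sub 29 14 7 ;; sub 29 29 28 ;; load 29 8 29 ;;
        ifLt 27 29 (add 27 29 4) skip)) skip ;;
    store 9 14 27

theorem updateEntry_spec {s : State} {a b c S k i p t : ℤ} (h3 : s.reg 3 = 1) (h4 : s.reg 4 = 0)
    (h7 : s.reg 7 = S) (ha : s.reg 30 = a) (hb : s.reg 31 = b) (hc : s.reg 16 = c)
    (hk : s.reg 14 = k) (hi : s.mem 10 k = i) (hp : s.mem 11 k = p)
    (ht : t = if s.mem 8 k < 0 then -1 else s.mem 8 k + 2 * (b + c - i)) (y : ℤ) :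
    (updateEntry.run s).mem 9 y = if y = k then
      (if 0 < i ∧ 2 * (a + (i - 1)) ≤ p then max t (s.mem 8 (k - S - 2 * (a + (i - 1)))) else t)
      else s.mem 9 y := by
  have ht' : t = if s.mem 8 k < 0 then -1 else s.mem 8 k + (c - i + b) + (c - i + b) := by
    rw [ht]; split_ifs <;> ring
  have hd : a + i - 1 + (a + i - 1) = 2 * (a + (i - 1)) := by ring
  rw [updateEntry]
  by_cases hT : s.mem 8 k < 0
  · rw [if_pos hT] at ht'
    subst ht'
    by_cases hi0 : 0 < i
    · by_cases hpd : p < 2 * (a + (i - 1))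
      · simp [h3, h4, ha, hk, hi, hp, hT, hi0, hd, hpd, not_le.2 hpd]
      · by_cases hm : -1 < s.mem 8 (k - S - 2 * (a + (i - 1)))
        · simp [h3, h4, h7, ha, hk, hi, hp, hT, hi0, hd, hpd, not_lt.1 hpd, hm, max_eq_right hm.le]
        · simp [h3, h4, h7, ha, hk, hi, hp, hT, hi0, hd, hpd, not_lt.1 hpd, hm,
            max_eq_left (not_lt.1 hm)]
    · simp [h4, hk, hi, hT, hi0]
  · rw [if_neg hT] at ht'
    by_cases hi0 : 0 < i
    · by_cases hpd : p < 2 * (a + (i - 1))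
      · simp [h3, h4, ha, hb, hc, hk, hi, hp, hT, hi0, hd, hpd, not_le.2 hpd, ← ht']
      · by_cases hm : t < s.mem 8 (k - S - 2 * (a + (i - 1)))
        · simp [h3, h4, h7, ha, hb, hc, hk, hi, hp, hT, hi0, hd, hpd, not_lt.1 hpd, hm, ← ht',
            max_eq_right hm.le]
        · simp [h3, h4, h7, ha, hb, hc, hk, hi, hp, hT, hi0, hd, hpd, not_lt.1 hpd, hm, ← ht',
            max_eq_left (not_lt.1 hm)]
    · simp [h4, hb, hc, hk, hi, hT, hi0, ← ht']

/-- Add a vertex with weights in registers `30` and `31` to a group of size in register `16`. -/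
def update : LoopProg := loop 14 8 updateEntry ;; loop 14 8 (load 20 9 14 ;; store 8 14 20)

/-- The red alternative reads a smaller address, which an upward pass in place would already have
overwritten. Hence the new entries go to array `9` and are copied back afterwards. -/
theorem update_spec {n S : ℕ} {adj : ℕ → ℕ → Bool} {x : ℕ → Bool} {L : ℕ → ℕ} {s : State}
    (h : Ready n adj x L S s) {a b c : ℕ} (ha : s.reg 30 = a) (hb : s.reg 31 = b)
    (hc : s.reg 16 = c) :
    ∀ y : ℕ, y < (n + 1) * S → (update.run s).mem 8 y = newEntry S (s.mem 8) a b c y := by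
  have first := loop_induction (r := 14) (b := 8) (p := updateEntry) (s := s) h.size
    (fun k s' => ∀ y < k, s'.mem 9 y = newEntry S (s.mem 8) a b c y) (by simp) (by
      intro k hk s' hF hr h1 y hy
      have hR := h.frame hF rfl
      have h10 := hR.indices k hk
      have h8 : s'.mem 8 = s.mem 8 := hF.mem 8 rfl
      rw [State.mem_set, updateEntry_spec hR.one hR.zero hR.width ((hF.reg 30 rfl).trans ha)
        ((hF.reg 31 rfl).trans hb) ((hF.reg 16 rfl).trans hc) hr h10.1 h10.2 rfl, h8]
      by_cases hyk : y = k
      · rw [if_pos (by rw [hyk]), hyk, newEntry]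
        have hdm := Nat.div_add_mod k S
        by_cases hcond : 0 < k / S ∧ 2 * (a + (k / S - 1)) ≤ k % S
        · have hS : S ≤ S * (k / S) := Nat.le_mul_of_pos_right _ hcond.1
          -- The natural subtraction in `newEntry` does not truncate: `k` contains a full row `S`,
          -- and the guard fits the rest into `k % S`.
          have haddr : (k : ℤ) - S - 2 * (a + ((k / S : ℕ) - 1)) =
              (k - S - 2 * (a + (k / S - 1)) : ℕ) := by lia
          rw [if_pos hcond, if_pos (by lia), haddr, blueEntry]
        · rw [if_neg hcond, if_neg (by lia), blueEntry]
      · rw [if_neg (by exact_mod_cast hyk)]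
        exact h1 y (by lia))
  have hR := h.frame (frame_run (loop 14 8 updateEntry) s) rfl
  have second := loop_induction (r := 14) (b := 8) (p := load 20 9 14 ;; store 8 14 20) hR.size
    (fun k s' => ∀ y < k, s'.mem 8 y = newEntry S (s.mem 8) a b c y) (by simp) (by
      intro k hk s' hF hr h1 y hy
      have h9 : s'.mem 9 k = newEntry S (s.mem 8) a b c k := by
        rw [hF.mem 9 rfl]; exact first k hk
      by_cases hyk : y = k
      · simp [hr, h9, hyk]
      · simpa [hr, hyk] using h1 y (by lia))
  exact second

/-- Merge all rows of the table into the first one. -/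
def merge : LoopProg :=
  loop 14 8 (load 20 10 14 ;; ifLt 4 20 (load 21 11 14 ;; load 22 8 14 ;; load 23 8 21 ;;
    ifLt 23 22 (store 8 21 22) skip ;; store 8 14 5) skip)

/-- One upward pass works in place: a cell beyond row 0 keeps its old value until it is compared
with the cell of its column in row 0, and is then reset to `-1`. The equivalence for all `q`
expresses a maximum. -/
theorem merge_spec {n S : ℕ} {adj : ℕ → ℕ → Bool} {x : ℕ → Bool} {L : ℕ → ℕ} {s : State}
    (h : Ready n adj x L S s) (hS : 0 < S) :
    (∀ p : ℕ, p < S → ∀ q : ℤ, q ≤ (merge.run s).mem 8 p ↔ ∃ i ≤ n, q ≤ s.mem 8 (i * S + p : ℕ)) ∧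
    (∀ y : ℕ, S ≤ y → y < (n + 1) * S → (merge.run s).mem 8 y = -1) := by
  have key := loop_induction (r := 14) (b := 8) (p := load 20 10 14 ;; ifLt 4 20 (load 21 11 14 ;;
      load 22 8 14 ;; load 23 8 21 ;; ifLt 23 22 (store 8 21 22) skip ;; store 8 14 5) skip)
    (s := s) h.size
    (fun k s' => (∀ p : ℕ, p < S → ∀ q : ℤ, q ≤ s'.mem 8 p ↔
        q ≤ s.mem 8 p ∨ ∃ y < k, S ≤ y ∧ y % S = p ∧ q ≤ s.mem 8 y) ∧
      (∀ y : ℕ, S ≤ y → y < k → s'.mem 8 y = -1) ∧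
      (∀ y : ℕ, S ≤ y → k ≤ y → s'.mem 8 y = s.mem 8 y))
    (by simp) (by
      intro k hk s' hF hr ⟨h1, h2, h3⟩
      have hR := h.frame hF rfl
      obtain ⟨h10, h11⟩ := hR.indices k hk
      by_cases hkS : S ≤ k
      · have hi : (0 : ℤ) < ((k / S : ℕ) : ℤ) := by exact_mod_cast Nat.div_pos hkS hS
        have hlt := Nat.mod_lt k hS
        obtain ⟨p, hp⟩ : ∃ p, k % S = p := ⟨_, rfl⟩
        rw [hp] at h11 hlt
        rw [← h10] at hi
        have hmem : ∀ y : ℕ, ((load 20 10 14 ;; ifLt 4 20 (load 21 11 14 ;;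
            load 22 8 14 ;; load 23 8 21 ;; ifLt 23 22 (store 8 21 22) skip ;;
            store 8 14 5) skip).run s').mem 8 y = if y = k then -1 else if y = p then
              max (s'.mem 8 p) (s'.mem 8 k) else s'.mem 8 y := by
          intro y
          by_cases hc : s'.mem 8 p < s'.mem 8 k
          · simp [hr, h11, hi, hR.zero, hR.neg, hc, max_eq_right hc.le]
          · by_cases hyp : y = p
            · simp [hr, h11, hi, hR.zero, hR.neg, hc, max_eq_left (not_lt.1 hc), hyp]
            · simp [hr, h11, hi, hR.zero, hR.neg, hc, hyp]
        simp only [State.mem_set, hmem]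
        refine ⟨fun y hy q => ?_, fun y hy hy' => ?_, fun y hy hy' => ?_⟩
        · rw [if_neg (by lia)]
          have hlast : (∃ z < k + 1, S ≤ z ∧ z % S = y ∧ q ≤ s.mem 8 z) ↔
              (∃ z < k, S ≤ z ∧ z % S = y ∧ q ≤ s.mem 8 z) ∨ (p = y ∧ q ≤ s.mem 8 k) := by
            constructor
            · rintro ⟨z, hz, hz'⟩
              rcases Nat.lt_succ_iff_lt_or_eq.1 hz with hz | rfl
              · exact .inl ⟨z, hz, hz'⟩
              · exact .inr ⟨hp ▸ hz'.2.1, hz'.2.2⟩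
            · rintro (⟨z, hz, hz'⟩ | ⟨hz, hz'⟩)
              · exact ⟨z, by lia, hz'⟩
              · exact ⟨k, by lia, hkS, hp.trans hz, hz'⟩
          rw [hlast, ← or_assoc, ← h1 y hy, ← h3 k hkS le_rfl]
          split_ifs with hyp
          · rw [le_max_iff, hyp]; simp
          · simp [Ne.symm hyp]
        · split_ifs with hyk hyp
          · rfl
          · lia
          · exact h2 y hy (by lia)
        · rw [if_neg (by lia), if_neg (by lia)]
          exact h3 y hy (by lia)
      · have hi : ¬ 0 < s'.mem 10 k := by rw [h10, Nat.div_eq_of_lt (by lia)]; simp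
        have hrun : ∀ y : ℕ, ((load 20 10 14 ;; ifLt 4 20 (load 21 11 14 ;;
            load 22 8 14 ;; load 23 8 21 ;; ifLt 23 22 (store 8 21 22) skip ;;
            store 8 14 5) skip).run s').mem 8 y = s'.mem 8 y := by
          intro y; simp [hr, hi, hR.zero]
        simp only [State.mem_set, hrun]
        refine ⟨fun y hy q => ?_, fun y hy hy' => by lia, fun y hy hy' => h3 y hy (by lia)⟩
        rw [h1 y hy]
        refine or_congr Iff.rfl ⟨?_, ?_⟩
        · rintro ⟨z, hz, hz'⟩; lia
        · rintro ⟨z, hz, hz'⟩; lia)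
  refine ⟨fun p hp q => ?_, key.2.1⟩
  refine (key.1 p hp q).trans ⟨?_, ?_⟩
  · rintro (hq | ⟨y, hy, hy', rfl, hq⟩)
    · exact ⟨0, by simp, by simpa using hq⟩
    · refine ⟨y / S, ?_, ?_⟩
      · have := Nat.div_lt_of_lt_mul (mul_comm (n + 1) S ▸ hy); lia
      · rwa [mul_comm, Nat.div_add_mod]
  · rintro ⟨i, hi, hq⟩
    rcases Nat.eq_zero_or_pos i with rfl | hi0
    · left; simpa using hq
    · right
      refine ⟨i * S + p, by nlinarith, by nlinarith, ?_, hq⟩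
      rw [mul_comm, Nat.mul_add_mod, Nat.mod_eq_of_lt hp]

/-- Run the dynamic program: the groups are processed in the order of their labels. -/
def dynamic : LoopProg :=
  loop 12 0 (const 16 0 ;; loop 13 0 (load 20 3 13 ;; ifLt 20 12 skip (ifLt 12 20 skip
    (load 30 6 13 ;; load 31 7 13 ;; update ;; add 16 16 3))) ;; merge)

/-- The outer invariant covers the vertices with label below `v`; the inner one adds those of label
`v` up to `k` and keeps the current group size in register `16`. Vertices with label `n` never
enter, which is how the deletion set stays out. -/
theorem dynamic_spec {n S : ℕ} {adj : ℕ → ℕ → Bool} {x : ℕ → Bool} {L : ℕ → ℕ} {s : State}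
    (h : Ready n adj x L S s) (hS : 0 < S) {a b : ℕ → ℕ}
    (hw : ∀ u < n, s.mem 6 u = a u ∧ s.mem 7 u = b u)
    (hT : IsTable S ((n + 1) * S) (s.mem 8) (Reach a b L ∅ 0)) :
    IsTable S ((n + 1) * S) ((dynamic.run s).mem 8) (Reach a b L (before n L n 0) n) := by
  refine loop_induction (r := 12) (b := 0) h.reg_n
    (fun v s' => IsTable S ((n + 1) * S) (s'.mem 8) (Reach a b L (before n L v 0) v))
    (by rw [before_zero]; exact hT) ?_
  intro v hv s' hF hr h1
  have hR := h.frame hF rfl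
  have inner := loop_induction (r := 13) (b := 0) (p := load 20 3 13 ;; ifLt 20 12 skip
      (ifLt 12 20 skip (load 30 6 13 ;; load 31 7 13 ;; update ;; add 16 16 3)))
    (s := s'.set 16 0) (N := n) (by simp [hR.reg_n])
    (fun k s'' => IsTable S ((n + 1) * S) (s''.mem 8) (Reach a b L (before n L v k) v) ∧
      s''.reg 16 = cnt L (before n L v k) v (fun _ => true)) (by
      refine ⟨h1, ?_⟩
      have : cnt L (before n L v 0) v (fun _ => true) = 0 := by
        refine sum_eq_zero fun w hw => ?_
        simp only [before, mem_filter] at hw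
        rw [if_neg]; lia
      simp [this]) (by
      intro k hk s'' hF' hr' ⟨h2, h3⟩
      have hR' : Ready n adj x L S s'' := (hR.frame (frame_run (const 16 0) s') rfl).frame hF' rfl
      have h12 : s''.reg 12 = v := by rw [hF'.reg 12 rfl]; simp [hr]
      have hlab := hR'.labels k hk
      by_cases hL : L k = v
      · have hw6 : s''.mem 6 k = a k := by
          rw [hF'.mem 6 rfl, State.mem_set, hF.mem 6 rfl]; exact (hw k hk).1
        have hw7 : s''.mem 7 k = b k := by
          rw [hF'.mem 7 rfl, State.mem_set, hF.mem 7 rfl]; exact (hw k hk).2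
        have hrun : (load 20 3 13 ;; ifLt 20 12 skip
            (ifLt 12 20 skip (load 30 6 13 ;; load 31 7 13 ;; update ;; add 16 16 3))).run s'' =
            (update ;; add 16 16 3).run
              ((load 20 3 13 ;; load 30 6 13 ;; load 31 7 13).run s'') := by
          simp [hr', hlab, h12, hL]
        rw [hrun]
        set s₁ := (load 20 3 13 ;; load 30 6 13 ;; load 31 7 13).run s'' with hs₁
        have hF₁ : (load 20 3 13 ;; load 30 6 13 ;; load 31 7 13).Frame s'' s₁ := frame_run _ _
        have hR₁ : Ready n adj x L S s₁ := hR'.frame hF₁ rfl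
        have hup := update_spec hR₁ (a := a k) (b := b k)
          (c := cnt L (before n L v k) v (fun _ => true))
          (by simp [hs₁, hr', hw6]) (by simp [hs₁, hr', hw7]) ((hF₁.reg 16 rfl).trans h3)
        rw [hF₁.mem 8 rfl] at hup
        have h16 : (update.run s₁).reg 16 = cnt L (before n L v k) v (fun _ => true) :=
          ((frame_run update s₁).reg 16 rfl).trans ((hF₁.reg 16 rfl).trans h3)
        have h31 : (update.run s₁).reg 3 = 1 := ((frame_run update s₁).reg 3 rfl).trans hR₁.one
        rw [before_succ_of_eq hk hL]
        refine ⟨isTable_newEntry (not_mem_before n hL) hL h2 hup, ?_⟩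
        rw [cnt_insert (not_mem_before n hL)]
        simp [h16, h31, hL]
      · have hrun : (load 20 3 13 ;; ifLt 20 12 skip
            (ifLt 12 20 skip (load 30 6 13 ;; load 31 7 13 ;; update ;; add 16 16 3))).run s'' =
            s''.set 20 (L k) := by
          rcases lt_or_gt_of_ne hL with hlt | hlt
          · simp [hr', hlab, h12, hlt]
          · simp [hr', hlab, h12, hlt]
        rw [hrun, before_succ_of_ne hL]
        exact ⟨h2, by simpa using h3⟩)
  set s₂ := (loop 13 0 (load 20 3 13 ;; ifLt 20 12 skip
      (ifLt 12 20 skip (load 30 6 13 ;; load 31 7 13 ;; update ;; add 16 16 3)))).run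
      (s'.set 16 0) with hs₂
  have hR₂ : Ready n adj x L S s₂ :=
    (hR.frame (frame_run (const 16 0) s') rfl).frame (frame_run _ _) rfl
  obtain ⟨m1, m2⟩ := merge_spec hR₂ hS
  have hin := inner.1
  -- The end of group `v` and the start of group `v + 1` involve the same vertices; only the label
  -- being counted changes.
  rw [before_last] at hin
  refine isTable_merge hS (card_before_le _ _ _ _) (fun w hw => ?_) hin
    (fun p hp q _ => m1 p hp q) m2
  simp only [before, mem_filter] at hw
  lia

/-- The integer `z` is the truth value of `Q`. -/
def Flag (z : ℤ) (Q : Prop) : Prop := z = 1 ∧ Q ∨ z = 0 ∧ ¬ Q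

/-- Set register `10` if the table contains a coloring with enough edges. -/
def check : LoopProg :=
  loop 14 7 (load 20 8 14 ;; ifLt 20 4 skip (add 21 17 14 ;; sub 21 21 1 ;; ifLt 21 1 skip
    (add 22 18 20 ;; sub 22 22 2 ;; ifLt 22 2 skip (const 10 1))))

theorem check_spec {S : ℕ} {s : State} {k₁ k₂ p₀ q₀ : ℤ} {Q : Prop} (h4 : s.reg 4 = 0)
    (hS : s.reg 7 = S)
    (h1 : s.reg 1 = k₁) (h2 : s.reg 2 = k₂) (h17 : s.reg 17 = p₀) (h18 : s.reg 18 = q₀)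
    (hQ : Flag (s.reg 10) Q) :
    Flag ((check.run s).reg 10)
      (Q ∨ ∃ p < S, 0 ≤ s.mem 8 p ∧ 2 * k₁ ≤ p₀ + p ∧ 2 * k₂ ≤ q₀ + s.mem 8 p) := by
  refine loop_induction (r := 14) (b := 7) hS
    (fun k s' => Flag (s'.reg 10)
      (Q ∨ ∃ p < k, 0 ≤ s.mem 8 p ∧ 2 * k₁ ≤ p₀ + p ∧ 2 * k₂ ≤ q₀ + s.mem 8 p))
    (by simpa using hQ) ?_
  intro k hk s' hF hr hinv
  have h8 : s'.mem 8 = s.mem 8 := hF.mem 8 rfl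
  have e4 : s'.reg 4 = 0 := (hF.reg 4 rfl).trans h4
  have e1 : s'.reg 1 = k₁ := (hF.reg 1 rfl).trans h1
  have e2 : s'.reg 2 = k₂ := (hF.reg 2 rfl).trans h2
  have e17 : s'.reg 17 = p₀ := (hF.reg 17 rfl).trans h17
  have e18 : s'.reg 18 = q₀ := (hF.reg 18 rfl).trans h18
  have hex : (∃ p < k + 1, 0 ≤ s.mem 8 p ∧ 2 * k₁ ≤ p₀ + p ∧ 2 * k₂ ≤ q₀ + s.mem 8 p) ↔
      (∃ p < k, 0 ≤ s.mem 8 p ∧ 2 * k₁ ≤ p₀ + p ∧ 2 * k₂ ≤ q₀ + s.mem 8 p) ∨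
      (0 ≤ s.mem 8 k ∧ 2 * k₁ ≤ p₀ + k ∧ 2 * k₂ ≤ q₀ + s.mem 8 k) := by
    constructor
    · rintro ⟨p, hp, hp'⟩
      rcases Nat.lt_succ_iff_lt_or_eq.1 hp with hp | rfl
      · exact .inl ⟨p, hp, hp'⟩
      · exact .inr hp'
    · rintro (⟨p, hp, hp'⟩ | hp')
      · exact ⟨p, by lia, hp'⟩
      · exact ⟨k, by lia, hp'⟩
  rw [hex, ← or_assoc]
  have hrun : ((((load 20 8 14 ;; ifLt 20 4 skip (add 21 17 14 ;; sub 21 21 1 ;; ifLt 21 1 skip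
      (add 22 18 20 ;; sub 22 22 2 ;; ifLt 22 2 skip (const 10 1)))).run s').set 14
      (k + 1 : ℕ))).reg 10 = if 0 ≤ s.mem 8 k ∧ 2 * k₁ ≤ p₀ + k ∧ 2 * k₂ ≤ q₀ + s.mem 8 k then 1
      else s'.reg 10 := by
    by_cases c1 : s.mem 8 k < 0
    · simp [hr, h8, e4, c1, not_le.2 c1]
    -- The program subtracts `k₁` once and compares with `k₁`, in place of doubling it; similarly
    -- for `k₂`.
    by_cases c2 : p₀ + k - k₁ < k₁
    · have : ¬ 2 * k₁ ≤ p₀ + k := by lia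
      simp [hr, h8, e4, c1, e17, e1, c2, this]
    by_cases c3 : q₀ + s.mem 8 k - k₂ < k₂
    · have : ¬ 2 * k₂ ≤ q₀ + s.mem 8 k := by lia
      simp [hr, h8, e4, c1, e17, e1, c2, e18, e2, c3, this]
    · have d2 : 2 * k₁ ≤ p₀ + k := by lia
      have d3 : 2 * k₂ ≤ q₀ + s.mem 8 k := by lia
      simp [hr, h8, e4, c1, e17, e1, c2, e18, e2, c3, not_lt.1 c1, d2, d3]
  rw [hrun]
  by_cases hc : 0 ≤ s.mem 8 k ∧ 2 * k₁ ≤ p₀ + k ∧ 2 * k₂ ≤ q₀ + s.mem 8 k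
  · rw [if_pos hc]; exact .inl ⟨rfl, .inr hc⟩
  · rw [if_neg hc]; simpa [Flag, hc] using hinv

/-! ### All colorings of the deletion set -/

/-- Search for a good coloring that extends the coloring with the number in register `11`. -/
def extend : LoopProg := decode ;; weights ;; inside ;; initTable ;; dynamic ;; check

/-- Search for a good coloring. -/
def search : LoopProg := const 10 0 ;; loop 11 9 extend

/-- By `pairs_eq` the value is part of a count of adjacent pairs. This guarantees that no coloring
falls off the table. -/
theorem value_le (n : ℕ) {adj : ℕ → ℕ → Bool} {x : ℕ → Bool} {L : ℕ → ℕ}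
    (hsymm : ∀ u w, adj u w = adj w u)
    (hL : ∀ u < n, ∀ w < n, x u = false → x w = false → (adj u w = true ↔ w ≠ u ∧ L w = L u))
    (f : ℕ → Bool) :
    value (nbrs n adj x f) L ({u ∈ range n | x u = false}) f ≤ pairs n adj (fun _ => true) := by
  have h := pairs_eq hsymm hL f
  have h' : pairs n adj f ≤ pairs n adj (fun _ => true) :=
    sum_le_sum fun u _ => sum_le_sum fun w _ => by
      by_cases ha : adj u w <;> cases f u <;> cases f w <;> simp [ha]
  lia

/-- The coloring of the deletion set `x` with number `c` extends to a coloring with enough edges. -/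
def Extends (n : ℕ) (adj : ℕ → ℕ → Bool) (x : ℕ → Bool) (k₁ k₂ : ℤ) (c : ℕ) : Prop :=
  ∃ f : ℕ → Bool, code x f n = c ∧ 2 * k₁ ≤ pairs n adj f ∧
    2 * k₂ ≤ pairs n adj (fun u => !f u)

theorem nbrs_congr {n : ℕ} {adj : ℕ → ℕ → Bool} {x f g : ℕ → Bool}
    (h : ∀ v < n, x v = true → f v = g v) (u : ℕ) : nbrs n adj x f u = nbrs n adj x g u :=
  sum_congr rfl fun w hw => by
    by_cases hx : x w
    · rw [h w (mem_range.1 hw) hx]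
    · simp [hx]

theorem base_congr {n : ℕ} {adj : ℕ → ℕ → Bool} {x f g : ℕ → Bool}
    (h : ∀ v < n, x v = true → f v = g v) : base n adj x f = base n adj x g :=
  sum_congr rfl fun w hw => by
    by_cases hx : x w
    · rw [h w (mem_range.1 hw) hx, nbrs_congr h]
    · simp [hx]

/-- A coloring with the code of `g` agrees with `g` on `x`, hence has the same weights, and
`pairs_eq` splits both of its counts into a constant and a value recorded in the table. Only row 0
matters, since no vertex outside `x` has label `n`. -/
theorem extends_iff {n S : ℕ} {adj : ℕ → ℕ → Bool} {x : ℕ → Bool} {L : ℕ → ℕ}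
    (hsymm : ∀ u w, adj u w = adj w u)
    (hL : ∀ u < n, ∀ w < n, x u = false → x w = false → (adj u w = true ↔ w ≠ u ∧ L w = L u))
    (hLn : ∀ u < n, L u < n ↔ x u = false)
    (hS : S = pairs n adj (fun _ => true) + 1) {T : ℤ → ℤ} {g : ℕ → Bool}
    (hT : IsTable S ((n + 1) * S) T
      (Reach (nbrs n adj x g) (nbrs n adj x (fun w => !g w)) L (before n L n 0) n))
    (k₁ k₂ : ℤ) :
    Extends n adj x k₁ k₂ (code x g n) ↔ ∃ p < S, 0 ≤ T (p : ℕ) ∧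
      2 * k₁ ≤ (base n adj x g : ℤ) + p ∧ 2 * k₂ ≤ (base n adj x (fun w => !g w) : ℤ) + T p := by
  have hD : before n L n 0 = {u ∈ range n | x u = false} := by
    ext w
    simp only [before, mem_filter, mem_range, and_congr_right_iff]
    intro hw
    rw [← hLn w hw]; lia
  rw [hD] at hT
  have hcnt : ∀ f, cnt L ({u ∈ range n | x u = false}) n f = 0 := fun f =>
    sum_eq_zero fun w hw => by
      simp only [mem_filter, mem_range] at hw
      have := (hLn w hw.1).2 hw.2
      rw [if_neg]; lia
  have hTp : ∀ p < S, ∀ q : ℤ, 0 ≤ q → (q ≤ T (p : ℕ) ↔ ∃ f : ℕ → Bool,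
      value (nbrs n adj x g) L ({u ∈ range n | x u = false}) f = p ∧
      q ≤ value (nbrs n adj x (fun w => !g w)) L ({u ∈ range n | x u = false})
        (fun w => !f w)) := by
    intro p hp q hq
    rw [hT p (by nlinarith) q hq, Nat.div_eq_of_lt hp, Nat.mod_eq_of_lt hp]
    simp only [Reach, hcnt, true_and]
  have hcomb : ∀ f : ℕ → Bool, (∀ v < n, x v = true → f v = g v) →
      pairs n adj f = base n adj x g +
        value (nbrs n adj x g) L ({u ∈ range n | x u = false}) f := by
    intro f hf
    rw [pairs_eq hsymm hL f, base_congr hf, funext (nbrs_congr hf)]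
  have hcomb' : ∀ f : ℕ → Bool, (∀ v < n, x v = true → f v = g v) →
      pairs n adj (fun w => !f w) = base n adj x (fun w => !g w) +
        value (nbrs n adj x (fun w => !g w)) L ({u ∈ range n | x u = false}) (fun w => !f w) := by
    intro f hf
    have hf' : ∀ v < n, x v = true → (!f v) = !g v := fun v hv hx => by rw [hf v hv hx]
    rw [pairs_eq hsymm hL (fun w => !f w), base_congr hf', funext (nbrs_congr hf')]
  constructor
  · rintro ⟨f, hc, h1, h2⟩
    have hf := code_injective hc
    have hle := value_le n hsymm hL f
    rw [funext (nbrs_congr hf)] at hle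
    rw [hcomb f hf] at h1
    rw [hcomb' f hf] at h2
    have hTq := (hTp _ (by lia) _ (by positivity)).2 ⟨f, rfl, le_rfl⟩
    push_cast at h1 h2
    exact ⟨_, by lia, by lia, h1, by lia⟩
  · rintro ⟨p, hp, h0, h1, h2⟩
    obtain ⟨f, hf, hq⟩ := (hTp p hp _ h0).1 le_rfl
    -- The table constrains `f` only outside `x`, so it can be glued to `g` on `x`.
    let f' : ℕ → Bool := fun w => if x w then g w else f w
    have hf' : ∀ v < n, x v = true → f' v = g v := fun v _ hx => by simp [f', hx]
    have e1 : value (nbrs n adj x g) L ({u ∈ range n | x u = false}) f' = p := by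
      rw [← hf]
      exact value_congr fun w hw => by simp [f', (mem_filter.1 hw).2]
    have e2 : value (nbrs n adj x (fun w => !g w)) L ({u ∈ range n | x u = false})
        (fun w => !f' w) = value (nbrs n adj x (fun w => !g w)) L
        ({u ∈ range n | x u = false}) (fun w => !f w) :=
      value_congr fun w hw => by simp [f', (mem_filter.1 hw).2]
    refine ⟨f', code_congr hf', ?_, ?_⟩
    · rw [hcomb f' hf', e1]; push_cast; exact h1
    · rw [hcomb' f' hf', e2]; push_cast; lia

theorem extend_spec {n S : ℕ} {adj : ℕ → ℕ → Bool} {x : ℕ → Bool} {L : ℕ → ℕ} {s : State}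
    {k₁ k₂ : ℤ} {Q : Prop} {c : ℕ}
    (h : Ready n adj x L S s) (hsymm : ∀ u w, adj u w = adj w u)
    (hL : ∀ u < n, ∀ w < n, x u = false → x w = false → (adj u w = true ↔ w ≠ u ∧ L w = L u))
    (hLn : ∀ u < n, L u < n ↔ x u = false) (hS : S = pairs n adj (fun _ => true) + 1)
    (hc : s.reg 11 = c) (hc' : c < 2 ^ below x n) (h1 : s.reg 1 = k₁) (h2 : s.reg 2 = k₂)
    (hQ : Flag (s.reg 10) Q) :
    Flag ((extend.run s).reg 10) (Q ∨ Extends n adj x k₁ k₂ c) := by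
  obtain ⟨g, rfl⟩ := exists_code_eq x n c hc'
  set s₁ := decode.run s with e₁
  have F₁ : decode.Frame s s₁ := frame_run _ _
  have R₁ := h.frame F₁ rfl
  have C₁ : HoldsColoring n x g s₁ := decode_spec h hc
  set s₂ := weights.run s₁ with e₂
  have F₂ : weights.Frame s₁ s₂ := frame_run _ _
  have R₂ := R₁.frame F₂ rfl
  have C₂ : HoldsColoring n x g s₂ := by
    rw [HoldsColoring, F₂.mem 4 rfl, F₂.mem 5 rfl]; exact C₁
  have W₂ := weights_spec R₁.toInput C₁
  rw [← e₂] at W₂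
  set s₃ := inside.run s₂ with e₃
  have F₃ : inside.Frame s₂ s₃ := frame_run _ _
  have R₃ := R₂.frame F₃ rfl
  obtain ⟨I₁, I₂⟩ := inside_spec R₂.toInput C₂ W₂
  rw [← e₃] at I₁ I₂
  set s₄ := initTable.run s₃ with e₄
  have F₄ : initTable.Frame s₃ s₄ := frame_run _ _
  have R₄ := R₃.frame F₄ rfl
  have T₄ := initTable_spec R₃ (nbrs n adj x g) (nbrs n adj x (fun w => !g w))
  rw [← e₄] at T₄
  have W₄ : ∀ u < n, s₄.mem 6 u = nbrs n adj x g u ∧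
      s₄.mem 7 u = nbrs n adj x (fun w => !g w) u := by
    rw [F₄.mem 6 rfl, F₄.mem 7 rfl, F₃.mem 6 rfl, F₃.mem 7 rfl]; exact W₂
  set s₅ := dynamic.run s₄ with e₅
  have F₅ : dynamic.Frame s₄ s₅ := frame_run _ _
  have R₅ := R₄.frame F₅ rfl
  have T₅ := dynamic_spec R₄ (by lia) W₄ T₄
  rw [← e₅] at T₅
  rw [extends_iff hsymm hL hLn hS T₅]
  have keep : ∀ r, (decode ;; weights ;; inside ;; initTable ;; dynamic).keeps r = true →
      s₅.reg r = s.reg r := fun r hr => (frame_run _ s).reg r hr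
  refine check_spec R₅.zero R₅.width ((keep 1 rfl).trans h1) ((keep 2 rfl).trans h2) ?_ ?_ ?_
  · rw [F₅.reg 17 rfl, F₄.reg 17 rfl, I₁]
  · rw [F₅.reg 18 rfl, F₄.reg 18 rfl, I₂]
  · rw [keep 10 rfl]; exact hQ

theorem search_spec {n S : ℕ} {adj : ℕ → ℕ → Bool} {x : ℕ → Bool} {L : ℕ → ℕ} {s : State}
    {k₁ k₂ : ℤ} (h : Ready n adj x L S s) (hsymm : ∀ u w, adj u w = adj w u)
    (hL : ∀ u < n, ∀ w < n, x u = false → x w = false → (adj u w = true ↔ w ≠ u ∧ L w = L u))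
    (hLn : ∀ u < n, L u < n ↔ x u = false) (hS : S = pairs n adj (fun _ => true) + 1)
    (h1 : s.reg 1 = k₁) (h2 : s.reg 2 = k₂) :
    Flag ((search.run s).reg 10) (∃ f : ℕ → Bool, 2 * k₁ ≤ pairs n adj f ∧
      2 * k₂ ≤ pairs n adj (fun u => !f u)) := by
  have h0 := h.frame (frame_run (const 10 0) s) rfl
  have key := loop_induction (r := 11) (b := 9) (p := extend) h0.colorings
    (fun k s' => Flag (s'.reg 10) (∃ c < k, Extends n adj x k₁ k₂ c)) (by simp [Flag]) (by
      intro k hk s' hF hr hinv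
      have := extend_spec (h0.frame hF rfl) hsymm hL hLn hS hr hk
        ((hF.reg 1 rfl).trans (by simpa using h1)) ((hF.reg 2 rfl).trans (by simpa using h2)) hinv
      have hex : (∃ c < k + 1, Extends n adj x k₁ k₂ c) ↔
          (∃ c < k, Extends n adj x k₁ k₂ c) ∨ Extends n adj x k₁ k₂ k := by
        constructor
        · rintro ⟨c, hc, hc'⟩
          rcases Nat.lt_succ_iff_lt_or_eq.1 hc with hc | rfl
          · exact .inl ⟨c, hc, hc'⟩
          · exact .inr hc'
        · rintro (⟨c, hc, hc'⟩ | hc')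
          · exact ⟨c, by lia, hc'⟩
          · exact ⟨k, by lia, hc'⟩
      rw [hex]
      simpa using this)
  have hex : (∃ c < 2 ^ below x n, Extends n adj x k₁ k₂ c) ↔ ∃ f : ℕ → Bool,
      2 * k₁ ≤ pairs n adj f ∧ 2 * k₂ ≤ pairs n adj (fun u => !f u) :=
    ⟨fun ⟨_, _, f, _, hf⟩ => ⟨f, hf⟩, fun ⟨f, hf⟩ => ⟨_, code_lt x f n, f, rfl, hf⟩⟩
  rwa [hex] at key

/-! ### Labels of a cluster graph -/

/-- Outside the set `x` there is no induced path on three vertices. -/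
def PathFree (n : ℕ) (adj : ℕ → ℕ → Bool) (x : ℕ → Bool) : Prop :=
  ∀ u < n, ∀ v < n, ∀ w < n, x u = false → x v = false → x w = false →
    adj u v = true → adj v w = true → u ≠ w → adj u w = true

/-- The last assignment wins, so the result is the greatest admissible neighbor, or `u` if no larger
one exists. -/
theorem labelBelow_spec (adj : ℕ → ℕ → Bool) (x : ℕ → Bool) (u k : ℕ) :
    (labelBelow adj x u k = u ∨ u < labelBelow adj x u k ∧ labelBelow adj x u k < k ∧
      x (labelBelow adj x u k) = false ∧ adj u (labelBelow adj x u k) = true) ∧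
    ∀ w < k, u < w → x w = false → adj u w = true → w ≤ labelBelow adj x u k := by
  induction k with
  | zero => simp [labelBelow]
  | succ k ih =>
    rw [labelBelow]
    split_ifs with h
    · exact ⟨.inr ⟨h.1, by lia, h.2.1, h.2.2⟩, fun w hw _ _ _ => by lia⟩
    · refine ⟨?_, fun w hw h1 h2 h3 => ?_⟩
      · rcases ih.1 with h' | h'
        · exact .inl h'
        · exact .inr ⟨h'.1, by lia, h'.2.2⟩
      · rcases Nat.lt_succ_iff_lt_or_eq.1 hw with hw | rfl
        · exact ih.2 w hw h1 h2 h3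
        · exact absurd ⟨h1, h2, h3⟩ h

theorem label_lt_iff {n : ℕ} (adj : ℕ → ℕ → Bool) (x : ℕ → Bool) {u : ℕ} (hu : u < n) :
    label n adj x u < n ↔ x u = false := by
  rw [label]
  cases hx : x u
  · rcases (labelBelow_spec adj x u n).1 with h | h
    · simp [h, hu]
    · simpa using h.2.1
  · simp

/-- The label is the greatest vertex of the clique. Vertices with a common label are each equal or
adjacent to it, and are then adjacent to each other because there is no induced path through it. -/
theorem label_spec {n : ℕ} {adj : ℕ → ℕ → Bool} {x : ℕ → Bool}
    (hsymm : ∀ u w, adj u w = adj w u) (hirr : ∀ u, adj u u = false) (hP : PathFree n adj x)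
    {u w : ℕ} (hu : u < n) (hw : w < n) (hxu : x u = false) (hxw : x w = false) :
    adj u w = true ↔ w ≠ u ∧ label n adj x w = label n adj x u := by
  have hl : ∀ v, x v = false → label n adj x v = labelBelow adj x v n := fun v hv => by
    simp [label, hv]
  -- If the label of `w` exceeds `u`, it is `w` itself or a neighbor of `w`; in the latter case
  -- path-freeness makes it a neighbor of `u` as well.
  have mono : ∀ u < n, ∀ w < n, x u = false → x w = false → adj u w = true →
      labelBelow adj x w n ≤ labelBelow adj x u n := by
    intro u hu w hw hxu hxw ha
    have h1 := labelBelow_spec adj x w n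
    have h2 := labelBelow_spec adj x u n
    have h3 : u ≤ labelBelow adj x u n := by lia
    by_cases hle : labelBelow adj x w n ≤ u
    · lia
    · rcases h1.1 with h4 | ⟨-, h4, h5, h6⟩
      · rw [h4] at hle ⊢
        exact h2.2 w hw (by lia) hxw ha
      · exact h2.2 _ h4 (by lia) h5 (hP u hu w hw _ h4 hxu hxw h5 ha h6 (by lia))
  rw [hl u hxu, hl w hxw]
  constructor
  · intro ha
    refine ⟨?_, le_antisymm (mono u hu w hw hxu hxw ha)
      (mono w hw u hu hxw hxu (by rw [hsymm]; exact ha))⟩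
    rintro rfl
    rw [hirr] at ha
    exact Bool.noConfusion ha
  · rintro ⟨hne, he⟩
    rcases (labelBelow_spec adj x u n).1 with h1 | ⟨-, h1, h2, h3⟩
    · rcases (labelBelow_spec adj x w n).1 with h4 | ⟨-, -, -, h4⟩
      · exact absurd (h4.symm.trans (he.trans h1)) hne
      · rw [hsymm]; rwa [he, h1] at h4
    · rcases (labelBelow_spec adj x w n).1 with h4 | ⟨-, -, -, h4⟩
      · rwa [← he, h4] at h3
      · rw [he, hsymm] at h4
        exact hP u hu _ h1 w hw hxu h2 hxw h3 h4 hne.symm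

/-! ### The algorithm for a given deletion set -/

/-- All preparations whose loops are over the vertices. -/
def prepare : LoopProg := tableWidth ;; tableSize ;; powers ;; labels

theorem ready_prepare {n : ℕ} {adj : ℕ → ℕ → Bool} {x : ℕ → Bool} {s : State}
    (h : Input n adj s) (hx : HoldsSet n x s) :
    Ready n adj x (label n adj x) (pairs n adj (fun _ => true) + 1)
      (indices.run (prepare.run s)) := by
  set S := pairs n adj (fun _ => true) + 1 with hS
  set s₁ := tableWidth.run s with e₁
  have F₁ : tableWidth.Frame s s₁ := frame_run _ _
  have R₁ := h.frame F₁ rfl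
  have W₁ : s₁.reg 7 = S := tableWidth_spec h
  have X₁ : HoldsSet n x s₁ := by rw [HoldsSet, F₁.mem 1 rfl]; exact hx
  set s₂ := tableSize.run s₁ with e₂
  have F₂ : tableSize.Frame s₁ s₂ := frame_run _ _
  have R₂ := R₁.frame F₂ rfl
  have W₂ : s₂.reg 8 = ((n + 1) * S : ℕ) := tableSize_spec R₁ W₁
  have X₂ : HoldsSet n x s₂ := by rw [HoldsSet, F₂.mem 1 rfl]; exact X₁
  set s₃ := powers.run s₂ with e₃
  have F₃ : powers.Frame s₂ s₃ := frame_run _ _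
  have R₃ := R₂.frame F₃ rfl
  obtain ⟨W₃, P₃⟩ := powers_spec R₂ X₂
  rw [← e₃] at W₃ P₃
  have X₃ : HoldsSet n x s₃ := by rw [HoldsSet, F₃.mem 1 rfl]; exact X₂
  have hp : prepare.run s = labels.run s₃ := rfl
  rw [hp]
  set s₄ := labels.run s₃ with e₄
  have F₄ : labels.Frame s₃ s₄ := frame_run _ _
  have R₄ := R₃.frame F₄ rfl
  have L₄ := labels_spec R₃ X₃
  rw [← e₄] at L₄
  have W₄ : s₄.reg 7 = S := by rw [F₄.reg 7 rfl, F₃.reg 7 rfl, F₂.reg 7 rfl, W₁]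
  have N₄ : s₄.reg 8 = ((n + 1) * S : ℕ) := by rw [F₄.reg 8 rfl, F₃.reg 8 rfl, W₂]
  have F₅ : indices.Frame s₄ (indices.run s₄) := frame_run _ _
  have R₅ := R₄.frame F₅ rfl
  exact
    { toInput := R₅
      set := by rw [HoldsSet, F₅.mem 1 rfl, F₄.mem 1 rfl]; exact X₃
      width := by rw [F₅.reg 7 rfl, W₄]
      size := by rw [F₅.reg 8 rfl, N₄]
      colorings := by rw [F₅.reg 9 rfl, F₄.reg 9 rfl, W₃]
      labels := by rw [F₅.mem 3 rfl]; exact L₄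
      indices := indices_spec W₄ (by lia) N₄ R₄.one
      powers := by rw [F₅.mem 12 rfl, F₄.mem 12 rfl]; exact P₃ }

theorem cost_prepare (β : ℕ → ℕ) : prepare.cost β ≤ 100 * (β 0 + 1) ^ 2 := by
  simp only [prepare, tableWidth, tableSize, powers, labels, entry, cost]
  nlinarith

theorem cost_indices (β : ℕ → ℕ) : indices.cost β ≤ 10 * (β 8 + 1) := by
  simp only [indices, cost]
  lia

/-- The table updates in `dynamic` dominate. `cost` charges both branches of a test, so it counts `n
^ 2` updates of `(n + 1) * S` entries each, although a vertex triggers an update only in the round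
of its label. -/
theorem cost_extend {β : ℕ → ℕ} {S : ℕ} (hS : 0 < S) (h7 : β 7 = S) (h8 : β 8 = (β 0 + 1) * S) :
    extend.cost β ≤ 200 * ((β 0 + 1) ^ 3 * S) := by
  have h1 : 1 ≤ (β 0 + 1) * S := Nat.mul_pos (by simp) hS
  have h2 : S ≤ (β 0 + 1) * S := Nat.le_mul_of_pos_left _ (by simp)
  have h3 : (β 0 + 1) ^ 3 * S = (β 0 + 1) ^ 2 * ((β 0 + 1) * S) := by ring
  rw [h3]
  simp only [extend, decode, weights, inside, initTable, dynamic, update, updateEntry, merge,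
    check, entry, cost, h7, h8]
  generalize (β 0 + 1) * S = N at *
  generalize β 0 = n at *
  have h4 : n * n ≤ n * n * N := Nat.le_mul_of_pos_right _ h1
  have h5 : n ≤ n * N := Nat.le_mul_of_pos_right _ h1
  have h6 : (n + 1) ^ 2 * N = n * n * N + 2 * (n * N) + N := by ring
  rw [h6]
  ring_nf at *
  lia

/-- Decide 2-Load Coloring, given a cluster deletion set. -/
def solve : Prog :=
  .seq prepare.compile (.seq indices.compile (.seq search.compile (.instr (.add 0 10 4))))

/-- The preparations are timed separately from the search because they write registers `7`, `8`,
`9`, whereas `exec_compile` requires constant loop bounds. Only `PathFree` is assumed of `x`, so the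
result serves given and computed sets alike. -/
theorem exec_solve {n : ℕ} (G : SimpleGraph (Fin n)) {x : ℕ → Bool} {k₁ k₂ : ℤ} {s : State}
    (h : Input n (adjOf G) s) (hx : HoldsSet n x s) (hP : PathFree n (adjOf G) x)
    (h1 : s.reg 1 = k₁) (h2 : s.reg 2 = k₂) :
    ∃ t s', Exec solve s t s' ∧ Flag (s'.reg 0) (HasLoadColoring G k₁ k₂) ∧
      t ≤ 400 * (2 ^ below x n * ((n + 1) ^ 3 * (2 * G.edgeSet.ncard + 1))) := by
  set S := 2 * G.edgeSet.ncard + 1 with hS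
  have hS' : pairs n (adjOf G) (fun _ => true) + 1 = S := by rw [pairs_true]
  -- One `β` serves all three pieces: it lists the final values, and `prepare` loops only over
  -- register `0`.
  set β : ℕ → ℕ := fun b =>
    if b = 0 then n else if b = 7 then S else if b = 8 then (n + 1) * S else
      if b = 9 then 2 ^ below x n else 1 with hβ
  set s₁ := prepare.run s with e₁
  have F₁ : prepare.Frame s s₁ := frame_run _ _
  have R₁ := h.frame F₁ rfl
  set s₂ := indices.run s₁ with e₂
  have F₂ : indices.Frame s₁ s₂ := frame_run _ _
  have R₂ : Ready n (adjOf G) x (label n (adjOf G) x) S s₂ := by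
    rw [← hS']; exact ready_prepare h hx
  have hirr : ∀ u, adjOf G u u = false := fun u => by simp [adjOf]
  have hflag := search_spec (k₁ := k₁) (k₂ := k₂) R₂ (adjOf_symm G)
    (fun u hu w hw hxu hxw => label_spec (adjOf_symm G) hirr hP hu hw hxu hxw)
    (fun u hu => label_lt_iff _ _ hu) hS'.symm
    (by rw [F₂.reg 1 rfl, F₁.reg 1 rfl, h1]) (by rw [F₂.reg 2 rfl, F₁.reg 2 rfl, h2])
  rw [← hasLoadColoring_iff] at hflag
  obtain ⟨t₁, ht₁, E₁⟩ := exec_compile (B := [3, 0]) (p := prepare) rfl (by simp) (β := β) h.one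
    (by simp [hβ, h.one, h.reg_n])
  obtain ⟨t₂, ht₂, E₂⟩ := exec_compile (B := [3, 8]) (p := indices) rfl (by simp) (β := β) R₁.one
    (by
      have h8 : s₁.reg 8 = ((n + 1) * S : ℕ) := (F₂.reg 8 rfl).symm.trans R₂.size
      simp only [List.mem_cons, List.not_mem_nil, or_false, forall_eq_or_imp, forall_eq, R₁.one,
        h8, Int.toNat_natCast]
      simp [hβ])
  obtain ⟨t₃, ht₃, E₃⟩ := exec_compile (B := [3, 0, 7, 8, 9]) (p := search) rfl (by simp) (β := β)
    R₂.one (by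
      simp only [List.mem_cons, List.not_mem_nil, or_false, forall_eq_or_imp, forall_eq, R₂.one,
        R₂.reg_n, R₂.width, R₂.size, R₂.colorings, Int.toNat_natCast]
      simp [hβ])
  have h4 : (search.run s₂).reg 4 = 0 := ((frame_run search s₂).reg 4 rfl).trans R₂.zero
  refine ⟨_, _, .seq E₁ (.seq E₂ (.seq E₃ (.instr _ _))), by simpa [Instr.apply, h4] using hflag,
    ?_⟩
  have c₁ := cost_prepare β
  have c₂ := cost_indices β
  have c₃ := cost_extend (β := β) (S := S) (by lia) rfl rfl
  have c₄ : search.cost β = 2 ^ below x n * (extend.cost β + 2) + 3 := by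
    simp only [search, cost]
    simp [hβ]
    ring
  have b0 : β 0 = n := rfl
  have b8 : β 8 = (n + 1) * S := rfl
  rw [b0] at c₁ c₃
  rw [b8] at c₂
  have hpos : 1 ≤ 2 ^ below x n := Nat.one_le_two_pow
  generalize 2 ^ below x n = K at *
  set Z := (n + 1) ^ 3 * S with hZ
  have z1 : (n + 1) ^ 2 ≤ Z := by
    calc (n + 1) ^ 2 ≤ (n + 1) ^ 2 * ((n + 1) * S) :=
          Nat.le_mul_of_pos_right _ (Nat.mul_pos (by simp) (by lia))
      _ = Z := by rw [hZ]; ring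
  have z2 : (n + 1) * S ≤ Z := by
    rw [hZ]
    exact Nat.mul_le_mul_right _ (Nat.le_self_pow (by simp) _)
  have z3 : 1 ≤ Z := le_trans (Nat.one_le_pow _ _ (by simp)) z1
  have z4 : Z ≤ K * Z := Nat.le_mul_of_pos_left _ hpos
  have z5 : K * (extend.cost β + 2) ≤ K * (202 * Z) := Nat.mul_le_mul_left _ (by lia)
  have z6 : K * (202 * Z) = 202 * (K * Z) := by ring
  lia

/-! ### Finding a deletion set -/

/-- The triple `(u, v, w)` is not an induced path outside `x`, or `w ≤ u`. -/
def Hit (adj : ℕ → ℕ → Bool) (x : ℕ → Bool) (u v w : ℕ) : Prop :=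
  x u = false → x v = false → x w = false → adj u v = true → adj v w = true → u < w →
    adj u w = true

/-- A path can be read from either end, so triples with `u < w` suffice. -/
theorem pathFree_of_hit {n : ℕ} {adj : ℕ → ℕ → Bool} {x : ℕ → Bool}
    (hsymm : ∀ u w, adj u w = adj w u)
    (h : ∀ u < n, ∀ v < n, ∀ w < n, Hit adj x u v w) : PathFree n adj x := by
  intro u hu v hv w hw xu xv xw h1 h2 hne
  rcases lt_or_gt_of_ne hne with hlt | hlt
  · exact h u hu v hv w hw xu xv xw h1 h2 hlt
  · rw [hsymm]
    exact h w hw v hv u hu xw xv xu (by rwa [hsymm]) (by rwa [hsymm]) hlt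

/-- `x` with three more elements. -/
def add3 (x : ℕ → Bool) (u v w : ℕ) (z : ℕ) : Bool :=
  x z || decide (z = u ∨ z = v ∨ z = w)

theorem Hit.add3 {adj : ℕ → ℕ → Bool} {x : ℕ → Bool} {a b c : ℕ} (h : Hit adj x a b c)
    (u v w : ℕ) : Hit adj (add3 x u v w) a b c := by
  intro h1 h2 h3
  simp only [LoopProg.add3, Bool.or_eq_false_iff] at h1 h2 h3
  exact h h1.1 h2.1 h3.1

theorem below_eq_card (x : ℕ → Bool) (k : ℕ) : below x k = #{v ∈ range k | x v = true} := by
  rw [below, card_filter]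

/-- `x` has at most three times as many elements as it has in common with any set that meets all
induced paths on three vertices. -/
def Packed (n : ℕ) (adj : ℕ → ℕ → Bool) (x : ℕ → Bool) : Prop :=
  ∀ y : ℕ → Bool, PathFree n adj y → below x n ≤ 3 * below (fun z => x z && y z) n

/-- The new vertices form an induced path outside `x`, which `y` must meet: the set grows by at most
three, its intersection with `y` by at least one. -/
theorem Packed.add3 {n : ℕ} {adj : ℕ → ℕ → Bool} {x : ℕ → Bool} (h : Packed n adj x)
    {u v w : ℕ} (hu : u < n) (hv : v < n) (hw : w < n) (xu : x u = false) (xv : x v = false)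
    (xw : x w = false) (h1 : adj u v = true) (h2 : adj v w = true) (h3 : adj u w = false)
    (h4 : u < w) : Packed n adj (add3 x u v w) := by
  intro y hy
  have hyp : ∃ z, (z = u ∨ z = v ∨ z = w) ∧ z < n ∧ x z = false ∧ y z = true := by
    by_contra hcon
    push Not at hcon
    have := hy u hu v hv w hw (by simpa using hcon u (by simp) hu xu)
      (by simpa using hcon v (by simp) hv xv) (by simpa using hcon w (by simp) hw xw) h1 h2 h4.ne
    rw [h3] at this
    exact Bool.noConfusion this
  obtain ⟨z, hz, hzn, xz, yz⟩ := hyp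
  have hle : below (LoopProg.add3 x u v w) n ≤ below x n + 3 := by
    rw [below_eq_card, below_eq_card]
    refine (card_le_card (t := {v ∈ range n | x v = true} ∪ {u, v, w}) ?_).trans
      ((card_union_le _ _).trans (Nat.add_le_add_left card_le_three _))
    intro a
    simp only [mem_filter, mem_union, mem_insert, mem_singleton, LoopProg.add3,
      Bool.or_eq_true, decide_eq_true_eq]
    tauto
  have hge : below (fun z => x z && y z) n + 1 ≤
      below (fun z => LoopProg.add3 x u v w z && y z) n := by
    rw [below_eq_card, below_eq_card, ← card_insert_of_notMem (a := z) (by simp [xz])]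
    refine card_le_card fun a => ?_
    simp only [mem_filter, mem_insert, LoopProg.add3, Bool.or_eq_true, decide_eq_true_eq,
      Bool.and_eq_true, mem_range]
    rintro (rfl | h)
    · exact ⟨hzn, .inr hz, yz⟩
    · tauto
  have := h y hy
  lia

/-- Put the vertices in registers `11`, `12`, `13` into the set if they form an induced path
outside of it. -/
def greedyStep : LoopProg :=
  ifLt 11 13 (load 20 1 11 ;; load 21 1 12 ;; load 22 1 13 ;; add 20 20 21 ;; add 20 20 22 ;;
    ifLt 4 20 skip (entry 20 11 13 ;; ifLt 4 20 skip (entry 20 11 12 ;; entry 21 12 13 ;;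
      add 20 20 21 ;; ifLt 3 20 (store 1 11 3 ;; store 1 12 3 ;; store 1 13 3) skip))) skip

/-- Collect disjoint induced paths on three vertices, until none is left. -/
def greedy : LoopProg := loop 11 0 (loop 12 0 (loop 13 0 greedyStep))

theorem greedyStep_spec {n : ℕ} {adj : ℕ → ℕ → Bool} {x : ℕ → Bool} {s : State}
    (h : Input n adj s) (hx : HoldsSet n x s) (hP : Packed n adj x) {u v w : ℕ} (hu : u < n)
    (hv : v < n) (hw : w < n) (h11 : s.reg 11 = u) (h12 : s.reg 12 = v) (h13 : s.reg 13 = w) :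
    ∃ x', HoldsSet n x' (greedyStep.run s) ∧ Packed n adj x' ∧ Hit adj x' u v w ∧
      ∀ a b c, Hit adj x a b c → Hit adj x' a b c := by
  have euv : s.mem 0 (s.mem 2 u + v) = if adj u v then 1 else 0 := h.mem_entry hu hv rfl rfl
  have evw : s.mem 0 (s.mem 2 v + w) = if adj v w then 1 else 0 := h.mem_entry hv hw rfl rfl
  have euw : s.mem 0 (s.mem 2 u + w) = if adj u w then 1 else 0 := h.mem_entry hu hw rfl rfl
  have xu := hx u hu
  have xv := hx v hv
  have xw := hx w hw
  by_cases c : x u = false ∧ x v = false ∧ x w = false ∧ adj u v = true ∧ adj v w = true ∧ u < w ∧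
      adj u w = false
  · obtain ⟨c1, c2, c3, c4, c5, c6, c7⟩ := c
    refine ⟨add3 x u v w, ?_, hP.add3 hu hv hw c1 c2 c3 c4 c5 c7 c6, ?_,
      fun a b c h => h.add3 u v w⟩
    · intro z hz
      have hxz := hx z hz
      by_cases z1 : z = w
      · simp [greedyStep, entry, h11, h12, h13, xu, xv, xw, euv, evw, euw, h.zero, h.one, c1, c2,
          c3, c4, c5, c6, c7, add3, z1]
      by_cases z2 : z = v
      · simp [greedyStep, entry, h11, h12, h13, xu, xv, xw, euv, evw, euw, h.zero, h.one, c1, c2,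
          c3, c4, c5, c6, c7, add3, z2]
      by_cases z3 : z = u
      · simp [greedyStep, entry, h11, h12, h13, xu, xv, xw, euv, evw, euw, h.zero, h.one, c1, c2,
          c3, c4, c5, c6, c7, add3, z3]
      · simp [greedyStep, entry, h11, h12, h13, xu, xv, xw, euv, evw, euw, h.zero, h.one, c1, c2,
          c3, c4, c5, c6, c7, add3, z1, z2, z3, hxz]
    · intro h1
      simp [add3] at h1
  · have hrun : (greedyStep.run s).mem 1 = s.mem 1 := by
      by_cases c6 : u < w
      · by_cases c0 : x u = false ∧ x v = false ∧ x w = false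
        · obtain ⟨c1, c2, c3⟩ := c0
          cases c7 : adj u w
          · have hle : ¬ 1 < s.mem 0 (s.mem 2 u + v) + s.mem 0 (s.mem 2 v + w) := by
              rw [euv, evw]
              cases c4 : adj u v <;> cases c5 : adj v w <;> simp
              exact c ⟨c1, c2, c3, c4, c5, c6, c7⟩
            simp [greedyStep, entry, h11, h12, h13, xu, xv, xw, euw, h.zero, h.one, c1, c2, c3,
              c6, c7, hle]
          · simp [greedyStep, entry, h11, h12, h13, xu, xv, xw, euw, h.zero, c1, c2, c3, c6, c7]
        · have hpos : 0 < s.mem 1 u + s.mem 1 v + s.mem 1 w := by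
            rw [xu, xv, xw]
            cases c1 : x u <;> cases c2 : x v <;> cases c3 : x w <;> simp
            exact c0 ⟨c1, c2, c3⟩
          simp [greedyStep, h11, h12, h13, h.zero, c6, hpos]
      · simp [greedyStep, h11, h13, c6]
    refine ⟨x, by rw [HoldsSet, hrun]; exact hx, hP, ?_, fun a b c h => h⟩
    intro c1 c2 c3 c4 c5 c6
    by_contra c7
    exact c ⟨c1, c2, c3, c4, c5, c6, by simpa using c7⟩

/-- The set only grows, so a triple once hit stays hit and a single pass over all triples is enough.
The nested invariants record the lexicographically earlier triples. -/
theorem greedy_spec {n : ℕ} {adj : ℕ → ℕ → Bool} {x : ℕ → Bool} {s : State}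
    (hsymm : ∀ u w, adj u w = adj w u)
    (h : Input n adj s) (hx : HoldsSet n x s) (hP : Packed n adj x) :
    ∃ x', HoldsSet n x' (greedy.run s) ∧ Packed n adj x' ∧ PathFree n adj x' := by
  have key := loop_induction (r := 11) (b := 0) (p := loop 12 0 (loop 13 0 greedyStep)) h.reg_n
    (fun i s' => ∃ x', HoldsSet n x' s' ∧ Packed n adj x' ∧
      ∀ a < i, ∀ b < n, ∀ c < n, Hit adj x' a b c) ⟨x, hx, hP, by simp⟩ (by
    rintro i hi s₁ F₁ r₁ ⟨x₁, H₁, P₁, A₁⟩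
    have I₁ := h.frame F₁ rfl
    have key₂ := loop_induction (r := 12) (b := 0) (p := loop 13 0 greedyStep) I₁.reg_n
      (fun j s' => ∃ x', HoldsSet n x' s' ∧ Packed n adj x' ∧
        (∀ a < i, ∀ b < n, ∀ c < n, Hit adj x' a b c) ∧ ∀ b < j, ∀ c < n, Hit adj x' i b c)
      ⟨x₁, H₁, P₁, A₁, by simp⟩ (by
      rintro j hj s₂ F₂ r₂ ⟨x₂, H₂, P₂, A₂, B₂⟩
      have I₂ := I₁.frame F₂ rfl
      have key₃ := loop_induction (r := 13) (b := 0) (p := greedyStep) I₂.reg_n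
        (fun k s' => ∃ x', HoldsSet n x' s' ∧ Packed n adj x' ∧
          (∀ a < i, ∀ b < n, ∀ c < n, Hit adj x' a b c) ∧
          (∀ b < j, ∀ c < n, Hit adj x' i b c) ∧ ∀ c < k, Hit adj x' i j c)
        ⟨x₂, H₂, P₂, A₂, B₂, by simp⟩ (by
        rintro k hk s₃ F₃ r₃ ⟨x₃, H₃, P₃, A₃, B₃, C₃⟩
        have I₃ := I₂.frame F₃ rfl
        obtain ⟨x', h1, h2, h3, h4⟩ := greedyStep_spec I₃ H₃ P₃ hi hj hk
          (by rw [F₃.reg 11 rfl, F₂.reg 11 rfl, r₁]) (by rw [F₃.reg 12 rfl, r₂]) r₃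
        refine ⟨x', h1, h2, fun a ha b hb c hc => h4 _ _ _ (A₃ a ha b hb c hc),
          fun b hb c hc => h4 _ _ _ (B₃ b hb c hc), fun c hc => ?_⟩
        rcases Nat.lt_succ_iff_lt_or_eq.1 hc with hc | rfl
        · exact h4 _ _ _ (C₃ c hc)
        · exact h3)
      obtain ⟨x', h1, h2, h3, h4, h5⟩ := key₃
      refine ⟨x', h1, h2, h3, fun b hb c hc => ?_⟩
      rcases Nat.lt_succ_iff_lt_or_eq.1 hb with hb | rfl
      · exact h4 b hb c hc
      · exact h5 c hc)
    obtain ⟨x', h1, h2, h3, h4⟩ := key₂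
    refine ⟨x', h1, h2, fun a ha b hb c hc => ?_⟩
    rcases Nat.lt_succ_iff_lt_or_eq.1 ha with ha | rfl
    · exact h3 a ha b hb c hc
    · exact h4 b hb c hc)
  obtain ⟨x', h1, h2, h3⟩ := key
  exact ⟨x', h1, h2, pathFree_of_hit hsymm h3⟩

/-! ### Encoded instances -/

open Classical in
/-- The characteristic function of a set of vertices. -/
noncomputable def indicator {n : ℕ} (X : Finset (Fin n)) (u : ℕ) : Bool :=
  decide (∃ h : u < n, (⟨u, h⟩ : Fin n) ∈ X)

theorem below_indicator {n : ℕ} (X : Finset (Fin n)) : below (indicator X) n = #X := by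
  rw [below, ← Fin.sum_univ_eq_sum_range (fun v => if indicator X v = true then 1 else 0) n]
  simp [indicator]

/-- Transitivity of the equivalence relation that defines the clusters. -/
theorem pathFree_indicator {n : ℕ} {G : SimpleGraph (Fin n)} {X : Finset (Fin n)}
    (h : IsClusterDeletionSet G X) : PathFree n (adjOf G) (indicator X) := by
  obtain ⟨r, hr⟩ := h
  intro u hu v hv w hw xu xv xw h1 h2 hne
  have hmem : ∀ z (hz : z < n), indicator X z = false → (⟨z, hz⟩ : Fin n) ∈ {v | v ∉ X} := by
    intro z hz hxz
    simpa [indicator, hz] using hxz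
  have adj_iff : ∀ a (ha : a < n) (xa : indicator X a = false) b (hb : b < n)
      (xb : indicator X b = false), adjOf G a b = true ↔
        a ≠ b ∧ r ⟨⟨a, ha⟩, hmem a ha xa⟩ ⟨⟨b, hb⟩, hmem b hb xb⟩ := by
    intro a ha xa b hb xb
    have := hr ⟨⟨a, ha⟩, hmem a ha xa⟩ ⟨⟨b, hb⟩, hmem b hb xb⟩
    simp only [SimpleGraph.comap_adj, Function.Embedding.subtype_apply, ne_eq, Subtype.mk.injEq,
      Fin.mk.injEq] at this
    rw [← this]
    simp [adjOf, ha, hb]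
  rw [adj_iff u hu xu v hv xv] at h1
  rw [adj_iff v hv xv w hw xw] at h2
  rw [adj_iff u hu xu w hw xw]
  exact ⟨hne, r.trans' h1.2 h2.2⟩

theorem holdsSet_encodeWith (I : Instance) (X : Finset (Fin I.n)) :
    HoldsSet I.n (indicator X) (I.encodeWith X) := by
  intro u hu
  have h : (∃ v : Fin I.n, u = (v : ℕ) ∧ v ∈ X) ↔ ∃ h : u < I.n, (⟨u, h⟩ : Fin I.n) ∈ X :=
    ⟨fun ⟨v, e, hv⟩ => ⟨hu, by subst e; exact hv⟩, fun ⟨h, hv⟩ => ⟨⟨u, h⟩, rfl, hv⟩⟩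
  simp [Instance.encodeWith, indicator, h]

theorem entries_encodeWith (I : Instance) (X : Finset (Fin I.n)) :
    ∀ u < I.n, ∀ w < I.n,
      (I.encodeWith X).mem 0 (u * I.n + w) = if adjOf I.graph u w then 1 else 0 := by
  intro u hu w hw
  have h : (∃ a b : Fin I.n, (u : ℤ) * I.n + w = ((a : ℕ) : ℤ) * I.n + ((b : ℕ) : ℤ) ∧
      I.graph.Adj a b) ↔ ∃ (hu : u < I.n) (hw : w < I.n), I.graph.Adj ⟨u, hu⟩ ⟨w, hw⟩ := by
    constructor
    · rintro ⟨a, b, e, hab⟩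
      have e' : I.n * u + w = I.n * a + b := by
        rw [mul_comm I.n u, mul_comm I.n]; exact_mod_cast e
      -- Quotient and remainder modulo `n` recover the row and the column from the address.
      have h1 := congrArg (· / I.n) e'
      have h2 := congrArg (· % I.n) e'
      have hpos : 0 < I.n := by lia
      simp only [Nat.mul_add_div hpos, Nat.div_eq_of_lt hw, Nat.div_eq_of_lt b.2, add_zero,
        Nat.mul_add_mod, Nat.mod_eq_of_lt hw, Nat.mod_eq_of_lt b.2] at h1 h2
      subst h1 h2
      exact ⟨a.2, b.2, hab⟩
    · rintro ⟨hu, hw, hab⟩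
      exact ⟨⟨u, hu⟩, ⟨w, hw⟩, rfl, hab⟩
  have hA : adjOf I.graph u w = true ↔
      ∃ (hu : u < I.n) (hw : w < I.n), I.graph.Adj ⟨u, hu⟩ ⟨w, hw⟩ := by simp [adjOf]
  simp only [Instance.encodeWith, zero_ne_one, false_and, if_false]
  by_cases hadj : adjOf I.graph u w = true
  · rw [if_pos ⟨rfl, h.2 (hA.1 hadj)⟩, if_pos hadj]
  · rw [if_neg (fun hB => hadj (hA.2 (h.1 hB.2))), if_neg hadj]

theorem input_encodeWith (I : Instance) (X : Finset (Fin I.n)) :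
    Input I.n (adjOf I.graph) (constants.run ((I.encodeWith X).set 3 1)) :=
  constants_spec (by simp [Instance.encodeWith]) (by simp) (entries_encodeWith I X)

/-! ### The two complete programs and their running times -/

theorem cost_constants (β : ℕ → ℕ) : constants.cost β ≤ 10 * (β 0 + 1) := by
  simp only [constants, cost]
  lia

theorem cost_greedy (β : ℕ → ℕ) : greedy.cost β ≤ 50 * (β 0 + 1) ^ 3 := by
  simp only [greedy, greedyStep, entry, cost]
  ring_nf
  lia

theorem answers_of_exec {p : Prog} {s s' : State} {t : ℕ} {Q : Prop} (h : Exec p s t s')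
    (hQ : Flag (s'.reg 0) Q) : Answers p s Q t := by
  refine ⟨s', h, ?_⟩
  rcases hQ with ⟨h1, h2⟩ | ⟨h1, h2⟩
  · rw [h1, if_pos h2]
  · rw [h1, if_neg h2]

theorem exec_init (I : Instance) (X : Finset (Fin I.n)) (p : LoopProg) (hp : p.wf [3, 0] = true) :
    ∃ t ≤ p.cost (fun b => if b = 0 then I.n else 1) + 1,
      Exec (.seq (.instr (.const 3 1)) p.compile) (I.encodeWith X) t
        (p.run ((I.encodeWith X).set 3 1)) := by
  obtain ⟨t, ht, E⟩ := exec_compile (s := (I.encodeWith X).set 3 1) hp (by simp) (by simp)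
    (β := fun b => if b = 0 then I.n else 1) (by simp [Instance.encodeWith])
  exact ⟨1 + t, by lia, .seq (.instr _ _) E⟩

/-- The algorithm for an instance with a cluster deletion set. -/
def solveFromSet : Prog := .seq (.seq (.instr (.const 3 1)) constants.compile) solve

/-- The algorithm for an instance alone. -/
def solveFromGraph : Prog :=
  .seq (.seq (.instr (.const 3 1)) (constants ;; greedy).compile) solve

theorem exists_solveFromSet (I : Instance) (X : Finset (Fin I.n))
    (hX : IsClusterDeletionSet I.graph X) :
    ∃ t, Answers solveFromSet (I.encodeWith X) I.IsYes t ∧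
      t ≤ 411 * (2 ^ #X * ((I.n + 1) ^ 3 * (2 * I.m + 1))) := by
  have F : constants.Frame ((I.encodeWith X).set 3 1) _ := frame_run _ _
  obtain ⟨t₁, ht₁, E₁⟩ := exec_init I X constants rfl
  obtain ⟨t₂, s', E₂, hf, ht₂⟩ := exec_solve I.graph (x := indicator X) (k₁ := I.k₁) (k₂ := I.k₂)
    (input_encodeWith I X)
    (by rw [HoldsSet, F.mem 1 rfl]; exact holdsSet_encodeWith I X) (pathFree_indicator hX)
    (by rw [F.reg 1 rfl]; simp [Instance.encodeWith])
    (by rw [F.reg 2 rfl]; simp [Instance.encodeWith])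
  refine ⟨_, answers_of_exec (.seq E₁ E₂) hf, ?_⟩
  have c := cost_constants (fun b => if b = 0 then I.n else 1)
  rw [below_indicator] at ht₂
  change t₂ ≤ 400 * (2 ^ #X * ((I.n + 1) ^ 3 * (2 * I.m + 1))) at ht₂
  simp only [if_true] at c
  have h1 : I.n + 1 ≤ (I.n + 1) ^ 3 := Nat.le_self_pow (by simp) _
  have h2 : (I.n + 1) ^ 3 ≤ (I.n + 1) ^ 3 * (2 * I.m + 1) := Nat.le_mul_of_pos_right _ (by lia)
  have h3 : (I.n + 1) ^ 3 * (2 * I.m + 1) ≤ 2 ^ #X * ((I.n + 1) ^ 3 * (2 * I.m + 1)) :=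
    Nat.le_mul_of_pos_left _ (by positivity)
  lia

/-- Deleting all vertices leaves an empty graph, so the infimum is over a nonempty set and is
attained. -/
theorem exists_clusterDeletionSet {n : ℕ} (G : SimpleGraph (Fin n)) :
    ∃ X : Finset (Fin n), IsClusterDeletionSet G X ∧ #X = clusterDistance G := by
  refine Nat.sInf_mem (s := {d | ∃ X : Finset (Fin n), IsClusterDeletionSet G X ∧ #X = d})
    ⟨_, univ, ⟨⊤, ?_⟩, rfl⟩
  rintro ⟨u, hu⟩
  simp at hu

/-- Array `1` starts as the empty set, which is trivially `Packed`. Comparing the greedy set with an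
optimal deletion set `Y` bounds its size by three times the distance. The constant is 400 + 50 + 10
+ 1, for `solve`, `greedy`, `constants` and setting register `3`. -/
theorem exists_solveFromGraph (I : Instance) :
    ∃ t, Answers solveFromGraph I.encode I.IsYes t ∧
      t ≤ 461 * (8 ^ clusterDistance I.graph * ((I.n + 1) ^ 3 * (2 * I.m + 1))) := by
  obtain ⟨Y, hY, hd⟩ := exists_clusterDeletionSet I.graph
  set s₀ := (I.encodeWith ∅).set 3 1
  have F : constants.Frame s₀ _ := frame_run _ _
  have F' : greedy.Frame (constants.run s₀) _ := frame_run _ _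
  obtain ⟨t₁, ht₁, E₁⟩ := exec_init I ∅ (constants ;; greedy) rfl
  obtain ⟨x, hx, hP, hfree⟩ := greedy_spec (adjOf_symm I.graph) (input_encodeWith I ∅)
    (by rw [HoldsSet, F.mem 1 rfl]; exact holdsSet_encodeWith I ∅)
    (fun y _ => by rw [below_indicator]; simp)
  obtain ⟨t₂, s', E₂, hf, ht₂⟩ := exec_solve I.graph (k₁ := I.k₁) (k₂ := I.k₂)
    ((input_encodeWith I ∅).frame F' rfl) hx hfree
    (by rw [F'.reg 1 rfl, F.reg 1 rfl]; simp [s₀, Instance.encodeWith])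
    (by rw [F'.reg 2 rfl, F.reg 2 rfl]; simp [s₀, Instance.encodeWith])
  refine ⟨_, answers_of_exec (.seq E₁ E₂) hf, ?_⟩
  have hle : below x I.n ≤ 3 * clusterDistance I.graph := by
    refine (hP _ (pathFree_indicator hY)).trans ?_
    rw [← hd, ← below_indicator Y]
    refine Nat.mul_le_mul_left _ (sum_le_sum fun z _ => ?_)
    by_cases hz : x z <;> simp [hz]
  have h8 : 2 ^ below x I.n ≤ 8 ^ clusterDistance I.graph :=
    (Nat.pow_le_pow_right (by simp) hle).trans (by rw [pow_mul]; rfl)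
  have c₁ := cost_constants (fun b => if b = 0 then I.n else 1)
  have c₂ := cost_greedy (fun b => if b = 0 then I.n else 1)
  simp only [if_true] at c₁ c₂
  simp only [cost] at ht₁
  have h1 : I.n + 1 ≤ (I.n + 1) ^ 3 := Nat.le_self_pow (by simp) _
  have h2 : (I.n + 1) ^ 3 ≤ (I.n + 1) ^ 3 * (2 * I.m + 1) := Nat.le_mul_of_pos_right _ (by lia)
  change t₂ ≤ 400 * (2 ^ below x I.n * ((I.n + 1) ^ 3 * (2 * I.m + 1))) at ht₂
  set Z := (I.n + 1) ^ 3 * (2 * I.m + 1)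
  have h3 : Z ≤ 8 ^ clusterDistance I.graph * Z := Nat.le_mul_of_pos_left _ (by positivity)
  have h4 := Nat.mul_le_mul_right Z h8
  lia

theorem two_mul_m_le (I : Instance) : 2 * I.m ≤ I.n * I.n := by
  rw [Instance.m, ← pairs_true]
  calc pairs I.n (adjOf I.graph) (fun _ => true)
      ≤ ∑ u ∈ range I.n, ∑ w ∈ range I.n, 1 :=
        sum_le_sum fun u _ => sum_le_sum fun w _ => by split_ifs <;> simp
    _ = I.n * I.n := by simp

theorem computable_const_mul_pow (c b : ℕ) : Computable fun d : ℕ => c * b ^ d := by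
  have h : Primrec fun d : ℕ => c * b ^ d := by
    have h' : Primrec (Nat.rec c fun _ y => y * b : ℕ → ℕ) :=
      Primrec.nat_rec₁ c (Primrec.nat_mul.comp₂ Primrec₂.right (Primrec₂.const b))
    refine h'.of_eq fun d => ?_
    induction d with
    | zero => simp
    | succ d ih => simp only [ih, pow_succ, mul_assoc]
  exact h.to_comp

end LoopProg
end LoadColoring

open LoadColoring LoadColoring.LoopProg

/-- 2-Load Coloring is fixed-parameter tractable parameterized by the distance to cluster graphs
(no deletion set being given), and there is one program that, given a cluster deletion set `X` of
size `k` along with the instance, decides 2-Load Coloring in time `O(2^k n^3 m^2)`. The product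
bound is claimed only for graphs with an edge (it is zero otherwise); the graph need not be
connected. -/
theorem theorem3 :
    LoadColoring.FixedParameterTractable
      LoadColoring.Instance.encode LoadColoring.Instance.size LoadColoring.Instance.IsYes
      (fun I => LoadColoring.clusterDistance I.graph) ∧
    ∃ (p : LoadColoring.Prog) (C : ℕ),
      ∀ (I : LoadColoring.Instance) (X : Finset (Fin I.n)),
        LoadColoring.IsClusterDeletionSet I.graph X →
          ∃ t : ℕ, LoadColoring.Answers p (I.encodeWith X) I.IsYes t ∧
            (0 < I.m → t ≤ C * 2 ^ X.card * I.n ^ 3 * I.m ^ 2) := by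
  refine ⟨⟨solveFromGraph, fun d => 461 * 8 ^ d, 4, computable_const_mul_pow 461 8, fun I => ?_⟩,
    solveFromSet, 9864, fun I X hX => ?_⟩
  · obtain ⟨t, hA, ht⟩ := exists_solveFromGraph I
    refine ⟨t, hA, ht.trans ?_⟩
    have hm := two_mul_m_le I
    -- The exponent 4 splits as three factors for `(n + 1) ^ 3` and one for `2 * m + 1`.
    have h1 : 2 * I.m + 1 ≤ I.size := by rw [Instance.size]; lia
    have h2 : I.n + 1 ≤ I.size := by rw [Instance.size]; nlinarith
    calc 461 * (8 ^ clusterDistance I.graph * ((I.n + 1) ^ 3 * (2 * I.m + 1)))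
        ≤ 461 * (8 ^ clusterDistance I.graph * (I.size ^ 3 * I.size)) := by gcongr
      _ = 461 * 8 ^ clusterDistance I.graph * I.size ^ 4 := by ring
  · obtain ⟨t, hA, ht⟩ := exists_solveFromSet I X hX
    refine ⟨t, hA, fun hm => ht.trans ?_⟩
    -- An edge forces a vertex, so `n + 1 ≤ 2 * n`. With `2 * m + 1 ≤ 3 * m ^ 2` this gives the
    -- constant 9864 = 411 · 8 · 3.
    have hn : 1 ≤ I.n := by
      have := two_mul_m_le I
      by_contra hn
      have : I.n = 0 := by lia
      simp_all
    have h1 : I.n + 1 ≤ 2 * I.n := by lia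
    have h2 : 2 * I.m + 1 ≤ 3 * I.m ^ 2 := by nlinarith
    calc 411 * (2 ^ X.card * ((I.n + 1) ^ 3 * (2 * I.m + 1)))
        ≤ 411 * (2 ^ X.card * ((2 * I.n) ^ 3 * (3 * I.m ^ 2))) := by gcongr
      _ = 9864 * 2 ^ X.card * I.n ^ 3 * I.m ^ 2 := by ring
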